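/- **Model.** A mixed-criticality (MC) task set $\tau=\{\tau_1,\dots,\tau_n\}$ consists of tasks with integer parameters: minimal release separation $T_i$, criticality level $L_i\ge 1$, relative deadline $D_i$, execution budgets $1\le C_i^1\le\dots\le C_i^{L_i}\le D_i\le T_i$, and relative virtual deadlines $1\le D_i^1\le\dots\le D_i^{L_i}\le D_i$. Put $C_i^0=D_i^0=0$ and $M=\max_i L_i$. Each task releases finitely or infinitely many jobs at integer times at least $T_i$ apart; a job has a real execution time of at most $C_i^{L_i}$, and it signals completion when it has executed for that long. Time is continuous. The system starts in mode $1$. In mode $m$ the unit-speed processor runs preemptive, work-conserving EDF on the pending jobs, where a job of $\tau_i$ released at $r$ has virtual deadline $r+D_i^m$ (ties are broken arbitrarily). As soon as a job of a task with $L_i\ge m$ has executed for $C_i^{m-1}$ without signalling completion, the mode becomes at least $m$. A job of a task with $L_i<m$ that is pending or released while the system is in mode $m$ is dropped. The system returns to mode $1$ whenever the processor is idle (and may also do so at any instant at which no earlier released job is pending). The task set is *EDF-schedulable in every criticality mode* if, in every such run and for every $m\in\{1,\dots,M\}$, every job of a task with $L_i\ge m$ whose execution time is at most $C_i^m$ completes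 by its deadline $r+D_i$, provided that the mode does not exceed $m$ between its release and this deadline. The utilization in mode $m$ is $U_m=\sum_{L_i\ge m}C_i^m/T_i$. **Multi-mode demand bound.** Let $m,e,S$ be integers with $1\le S\le e$. For $m=1$ let $dbf_{MM}(\tau_i,S,e,1)=\left(\lfloor (e-D_i^1)/T_i\rfloor+1\right)C_i^1$. For $m\ge 2$ and a job of $\tau_i$ released at $r$, consider the conditions (1) $r+D_i^{m-2}<0$; (2) $r+D_i^{m-1}<S$; (3) $r+D_i^m\le e$; (4) $r+D_i^{m-1}\le e$, and put $q(r)=\min\{r+D_i^{m-2},C_i^{m-2}\}-C_i^{m-2}$. Define - $A(r)=\min\{C_i^{m-1}+q(r),\,S\}$ if $\neg(1)\wedge(4)$, and $0$ otherwise; - $B(r)=\min\{C_i^{m-1},\,S-r\}$ if $(4)$, and $0$ otherwise; - $C(r)=0$ if $(1)\vee\neg(4)$; otherwise $C_i^{m-1}+q(r)$ if $(2)$; $C_i^m+q(r)$ if $\neg(2)\wedge(3)$; $\min\{S,\,C_i^{m-1}+q(r)\}$ if $\neg(2)\wedge\neg(3)$; - $D(r)=0$ if $\neg(4)$; otherwise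 $C_i^{m-1}$ if $(2)$; $C_i^m$ if $\neg(2)\wedge(3)$; $\min\{C_i^{m-1},\,S-r\}$ if $\neg(2)\wedge\neg(3)$. (These bound the demands of the carry-over jobs $J^A,J^B,J^C,J^D$.) With $\nu=\lfloor (S-r-T_i)/T_i\rfloor$ and $k=\max\{0,\lfloor (e-r-(\nu+2)T_i-D_i^m)/T_i\rfloor+1\}$ let - for $L_i=m-1$: $DEM_i(r)=A(r)$ if $r+T_i>S$, and $DEM_i(r)=A(r)+\nu C_i^{m-1}+B(r+(\nu+1)T_i)$ otherwise; - for $L_i\ge m$: $DEM_i(r)=C(r)+kC_i^m$ if $r+T_i>S$, and $DEM_i(r)=C(r)+\nu C_i^{m-1}+D(r+(\nu+1)T_i)+kC_i^m$ otherwise. Finally $dbf_{MM}(\tau_i,S,e,m)=\max_{r\in\{0,-1,\dots,-T_i\}}DEM_i(r)$ for $m\ge2$, and $dbf_{MM}(\tau,S,e,m)=\sum_{L_i\ge m-1}dbf_{MM}(\tau_i,S,e,m)$. **Theorem.** There is a function $\tau\mapsto e^{max}(\tau)\in\mathbb N\cup\{\infty\}$ on MC task sets such that: 1. $\tau$ is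 EDF-schedulable in every criticality mode if $$\forall m\in\{1,\dots,M\}\ \ \forall e\in\mathbb N\text{ with }1\le e\le e^{max}(\tau)\ \ \forall S_m\in\{1,\dots,e\}:\quad dbf_{MM}(\tau,S_m,e,m)\le e .$$ 2. No interval length beyond $e^{max}(\tau)$ needs to be tested: if $dbf_{MM}(\tau,S_m,e,m)>e$ for some $m\in\{1,\dots,M\}$ and $1\le S_m\le e$, then $e\le e^{max}(\tau)$. 3. $e^{max}$ is pseudo-polynomial when the utilization of each mode is bounded by a constant below $1$: for every real $c<1$ there is a polynomial $p$ with natural coefficients such that $e^{max}(\tau)\le p(|\tau|)$ for every $\tau$ with $U_m\le c$ for all $m\in\{1,\dots,M\}$, where $|\tau|=\sum_i\bigl(T_i+L_i+D_i+\sum_{m=1}^{L_i}(C_i^m+D_i^m)\bigr)$ is the size of $\tau$ in unary. -/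

import Mathlib

open MeasureTheory

/-- A mixed-criticality sporadic task with constrained deadline, together with its virtual deadlines.
`C m` and `V m` are the execution budget and the relative virtual deadline at level `m`; only the
levels `1, …, L` are meaningful. Level `0` (nothing precedes the initial mode) is given the values
`0`, so that no job is carried over into mode `1`. -/
structure MCTask where
  /-- minimal separation of releases -/
  T : ℕ
  /-- criticality level -/
  L : ℕ
  /-- relative deadline -/
  D : ℕ
  /-- execution budgets -/
  C : ℕ → ℕ
  /-- relative virtual deadlines -/
  V : ℕ → ℕ
  one_le_L : 1 ≤ L
  C_zero : C 0 = 0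
  V_zero : V 0 = 0
  one_le_C : 1 ≤ C 1
  one_le_V : 1 ≤ V 1
  C_mono : ∀ m, 1 ≤ m → m < L → C m ≤ C (m + 1)
  V_mono : ∀ m, 1 ≤ m → m < L → V m ≤ V (m + 1)
  C_le_D : C L ≤ D
  V_le_D : V L ≤ D
  D_le_T : D ≤ T

/-! ### The multi-mode demand bound function

The interval of interest is `[0, e)`, where mode `m - 1` is entered at time `0` and mode `m` at time
`S`. The functions below are used for `m ≥ 2` only. In each of them `r` is the release time of the
carry-over job in question. -/

namespace MCTask

/-- Demand of a job `J^A` (of a task of level `m - 1`, released before `0`). -/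
def demandA (t : MCTask) (m : ℕ) (S e r : ℤ) : ℤ :=
  if ¬ (r + t.V (m - 2) < 0) ∧ r + t.V (m - 1) ≤ e then
    min (min (r + t.V (m - 2)) (t.C (m - 2)) + t.C (m - 1) - t.C (m - 2)) S
  else 0

/-- Demand of a job `J^B` (of a task of level `m - 1`, the last one released in `[0, S]`). -/
def demandB (t : MCTask) (m : ℕ) (S e r : ℤ) : ℤ :=
  if r + t.V (m - 1) ≤ e then min (t.C (m - 1) : ℤ) (S - r) else 0

/-- Demand of a job `J^C` (of a task of level `≥ m`, released before `0`). -/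
def demandC (t : MCTask) (m : ℕ) (S e r : ℤ) : ℤ :=
  if r + t.V (m - 2) < 0 ∨ ¬ (r + t.V (m - 1) ≤ e) then 0
  else if r + t.V (m - 1) < S then
    t.C (m - 1) - t.C (m - 2) + min (r + t.V (m - 2)) (t.C (m - 2))
  else if r + t.V m ≤ e then
    t.C m - t.C (m - 2) + min (r + t.V (m - 2)) (t.C (m - 2))
  else
    min S (t.C (m - 1) - t.C (m - 2) + min (r + t.V (m - 2)) (t.C (m - 2)))

/-- Demand of a job `J^D` (of a task of level `≥ m`, the last one released in `[0, S]`). -/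
def demandD (t : MCTask) (m : ℕ) (S e r : ℤ) : ℤ :=
  if ¬ (r + t.V (m - 1) ≤ e) then 0
  else if r + t.V (m - 1) < S then t.C (m - 1)
  else if r + t.V m ≤ e then t.C m
  else min (t.C (m - 1) : ℤ) (S - r)

/-- Demand of a task of level `m - 1` whose job `J^A` is released at `r`, all later jobs being
released as soon as possible. (`/` on `ℤ` rounds down, since `T > 0`.) -/
def demLow (t : MCTask) (m : ℕ) (S e r : ℤ) : ℤ :=
  if r + t.T > S then t.demandA m S e r
  else
    let n := (S - (r + t.T)) / t.T
    t.demandA m S e r + n * t.C (m - 1) + t.demandB m S e (r + (n + 1) * t.T)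

/-- Demand of a task of level `≥ m` whose job `J^C` is released at `r`, all later jobs being
released as soon as possible. Here `n` is the number of jobs between `J^C` and `J^D`
(it is `-1` if there is no `J^D`), and `k` is the number of jobs released after `J^D`
(after `J^C` if there is no `J^D`) with mode-`m` deadline at most `e`. -/
def demHigh (t : MCTask) (m : ℕ) (S e r : ℤ) : ℤ :=
  let n := (S - r - t.T) / t.T
  let k := max 0 ((e - (r + (n + 2) * t.T) - t.V m) / t.T + 1)
  if S ≥ r + t.T then
    t.demandC m S e r + n * t.C (m - 1) + t.demandD m S e (r + (n + 1) * t.T) + k * t.C m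
  else t.demandC m S e r + k * t.C m

/-- Multi-mode demand bound of one task, for integer release times: in mode `1` it is the demand bound
of an ordinary sporadic task, in mode `m ≥ 2` the maximum over the release time of the carry-over job,
which ranges over `0, -1, …, -T`. Tasks of level `< m - 1` do not execute in the interval. -/
noncomputable def dbfMM (t : MCTask) (S e : ℤ) (m : ℕ) : ℤ :=
  if m = 1 then ((e - t.V 1) / t.T + 1) * t.C 1
  else if t.L + 1 < m then 0
  else if t.L + 1 = m then
    (Finset.Icc (-(t.T : ℤ)) 0).sup' ⟨0, by simp⟩ (t.demLow m S e)
  else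
    (Finset.Icc (-(t.T : ℤ)) 0).sup' ⟨0, by simp⟩ (t.demHigh m S e)

end MCTask

/-- A job is named by its task and its release time (release times are integers). -/
abbrev MCJob (n : ℕ) := Fin n × ℕ

namespace MCTaskSet

variable {n : ℕ}

/-- The number of criticality levels, `M = max L_i`. -/
def maxLevel (τ : Fin n → MCTask) : ℕ := Finset.univ.sup fun i => (τ i).L

/-- Multi-mode demand bound of a task set. -/
noncomputable def dbfMM (τ : Fin n → MCTask) (S e : ℤ) (m : ℕ) : ℤ :=
  ∑ i with m ≤ (τ i).L + 1, (τ i).dbfMM S e m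

/-- Utilization of the task set in mode `m`. -/
noncomputable def utilization (τ : Fin n → MCTask) (m : ℕ) : ℝ :=
  ∑ i with m ≤ (τ i).L, ((τ i).C m : ℝ) / (τ i).T

/-- Size of the task set when all of its numbers are written in unary; a quantity is
pseudo-polynomial in the input if it is bounded by a polynomial in this size. -/
def unarySize (τ : Fin n → MCTask) : ℕ :=
  ∑ i, ((τ i).T + (τ i).L + (τ i).D + ∑ m ∈ Finset.Icc 1 (τ i).L, ((τ i).C m + (τ i).V m))

end MCTaskSet

/-! ### EDF runs in continuous time -/

/-- The data of a run of the system on a unit-speed uniprocessor, over the time axis `t ≥ 0`. -/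
structure MCTrace (n : ℕ) where
  /-- the release times of the jobs of each task (finitely or infinitely many) -/
  releases : Fin n → Set ℕ
  /-- the actual execution time after which a job signals completion -/
  demand : MCJob n → ℝ
  /-- the job that occupies the processor, if any -/
  sched : ℝ → Option (MCJob n)
  /-- the criticality mode of the system -/
  mode : ℝ → ℕ
  /-- the instants at which the system is switched back to mode `1` -/
  resets : Set ℝ

namespace MCTrace

variable {n : ℕ}

/-- Amount of execution that job `J` has received before time `t`. -/
noncomputable def executed (x : MCTrace n) (J : MCJob n) (t : ℝ) : ℝ :=
  volume.real {s : ℝ | 0 ≤ s ∧ s < t ∧ x.sched s = some J}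

/-- Job `J` has signalled completion by time `t`. -/
def Finished (x : MCTrace n) (J : MCJob n) (t : ℝ) : Prop :=
  x.demand J ≤ x.executed J t

/-- Job `J` is pending at time `t`: it has been released, it is unfinished, and it has not been
dropped, i.e. the mode has not exceeded the level of its task since its release. -/
def Pending (τ : Fin n → MCTask) (x : MCTrace n) (J : MCJob n) (t : ℝ) : Prop :=
  J.2 ∈ x.releases J.1 ∧ (J.2 : ℝ) ≤ t ∧ ¬ x.Finished J t ∧
    ∀ s : ℝ, (J.2 : ℝ) ≤ s → s ≤ t → x.mode s ≤ (τ J.1).L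

/-- The trace is an EDF run of the task set `τ`: in mode `m` the scheduler is preemptive and
work-conserving and uses the virtual deadlines of level `m`, ties being broken arbitrarily. -/
structure IsEDFRun (τ : Fin n → MCTask) (x : MCTrace n) : Prop where
  sporadic : ∀ i, ∀ r ∈ x.releases i, ∀ r' ∈ x.releases i, r < r' → r + (τ i).T ≤ r'
  demand_nonneg : ∀ J, 0 ≤ x.demand J
  /-- no job exceeds its budget at the highest level of its task -/
  demand_le : ∀ J, x.demand J ≤ (τ J.1).C (τ J.1).L
  measurable : ∀ J, MeasurableSet {s : ℝ | x.sched s = some J}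
  /-- the processor idles only if no job is pending -/
  work_conserving : ∀ t : ℝ, 0 ≤ t → x.sched t = none → ∀ J, ¬ Pending τ x J t
  /-- the running job is a pending one with the earliest virtual deadline for the current mode -/
  edf : ∀ t : ℝ, 0 ≤ t → ∀ J, x.sched t = some J → Pending τ x J t ∧
    ∀ J', Pending τ x J' t →
      J.2 + (τ J.1).V (x.mode t) ≤ J'.2 + (τ J'.1).V (x.mode t)
  /-- the system may be switched back to mode `1` only at an instant at which no previously
  released job is pending -/
  reset_idle : ∀ t ∈ x.resets, 0 ≤ t ∧ ∀ J : MCJob n, (J.2 : ℝ) < t → ¬ Pending τ x J t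
  /-- and it is switched back whenever the processor is idle -/
  idle_reset : ∀ t : ℝ, 0 ≤ t → (∀ J, ¬ Pending τ x J t) → t ∈ x.resets
  /-- the mode is at least `m ≥ 2` exactly if, since the last switch back to mode `1`, some job of a
  task of level at least `m` has executed for its whole level-`(m - 1)` budget without signalling
  completion -/
  mode_iff : ∀ t : ℝ, 0 ≤ t → ∀ m : ℕ, m ≤ x.mode t ↔
    m ≤ 1 ∨ ∃ s : ℝ, 0 ≤ s ∧ s ≤ t ∧ (∀ u : ℝ, s < u → u ≤ t → u ∉ x.resets) ∧
      ∃ J, Pending τ x J s ∧ m ≤ (τ J.1).L ∧ ((τ J.1).C (m - 1) : ℝ) ≤ x.executed J s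

end MCTrace

namespace MCTaskSet

variable {n : ℕ}

/-- The task set is schedulable by EDF in every criticality mode: in each run and for each mode `m`,
every job of a task of level at least `m` that needs no more than its level-`m` budget signals
completion by its deadline, unless the system leaves the modes up to `m` before that deadline. -/
def EDFSchedulable (τ : Fin n → MCTask) : Prop :=
  ∀ x : MCTrace n, x.IsEDFRun τ → ∀ m : ℕ, 1 ≤ m → m ≤ maxLevel τ →
    ∀ J : MCJob n, J.2 ∈ x.releases J.1 → m ≤ (τ J.1).L → x.demand J ≤ (τ J.1).C m →
      (∀ s : ℝ, (J.2 : ℝ) ≤ s → s < J.2 + (τ J.1).D → x.mode s ≤ m) →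
        x.Finished J (J.2 + (τ J.1).D)

end MCTaskSet

/-!
# Schedulability of mixed-criticality task sets by the multi-mode demand bound

`eMax` is taken to be the supremum `testBound` of all interval lengths that violate the test, so that
the test up to `eMax` is the test for all lengths (`PassesTest`). Since the demand of a task in
`[0, e)` is, up to `3 T`, its level-`(m - 1)` rate before the mode switch and its level-`m` rate after
it, the total demand is at most `c e + 3 |τ|` if all utilizations are at most `c`, and a violating
`e` is linear in `|τ|` if `c < 1` (`testBound_le`).

For schedulability, consider a busy episode of a run: a time span from an integer instant with no
earlier work left, up to the deadline of a late job. The mode can only increase there. The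
invariant `Fits`, proved by induction on the mode (`fits_one`, `fits_add_two`), says that at any
time `t` of mode `m`, the worst-case residual level-`m` demand of the jobs with virtual deadlines
up to `d` is at most `d - t`. It includes the instants at which a mode is entered and left, even if
that is the same instant, and a late job contradicts it.

The induction step is a processor demand argument from the entry `O` into mode `m - 1`, or from the
last later instant at which no job with a virtual deadline up to `d` was waiting. What the processor
has executed since then, plus the residual demand, is bounded task by task by `dbfMM`. Three points
need care.

* Actual releases are less dense than those in the definition of `dbfMM`. They are compared with a
  dense pattern that keeps the last release before the mode switch fixed, if possible
  (`exists_pattern`).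
* `O` is a real number, while the test has an integer origin. Moving the origin within a unit
  interval changes the demand affinely. Either some carry-over job loses demand at unit rate, and
  the origin may be rounded down, or none does, and it may be rounded up (`fits_add_two`). The
  invariant for mode `m - 2` at time `O` bounds the carry-over demand.
* The instant `S` of the switch into mode `m` is rounded up, unless a job whose successor is
  released at `⌈S⌉` still demands its level-`m` budget. In that case it is rounded down, and the
  joint residual bound in mode `m - 1` for that job and any other one shows that no demand is lost
  (`ran_le_of_unfinished`, `exists_switch`).
-/

/-! ### Packing separated releases -/

/-- At most `N` integers with pairwise distances at least `T` fit into `[a, a + N T)`. -/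
theorem card_le_of_separated {T : ℤ} (hT : 0 < T) {R : Finset ℤ} {a : ℤ} {N : ℕ}
    (hsep : ∀ r ∈ R, ∀ r' ∈ R, r < r' → r + T ≤ r')
    (ha : ∀ r ∈ R, a ≤ r) (hb : ∀ r ∈ R, r < a + N * T) : R.card ≤ N := by
  have : R.card ≤ (Finset.Ico (0 : ℤ) N).card := by
    refine Finset.card_le_card_of_injOn (fun r => (r - a) / T) ?_ ?_
    · intro r hr
      have h1 := ha r hr
      have h2 := hb r hr
      simp only [Finset.coe_Ico, Set.mem_Ico]
      exact ⟨Int.ediv_nonneg (by omega) hT.le, Int.ediv_lt_of_lt_mul hT (by linarith)⟩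
    · have key : ∀ r ∈ R, ∀ r' ∈ R, r < r' → (r - a) / T ≠ (r' - a) / T := by
        intro r hr r' hr' hlt he
        have h := hsep r hr r' hr' hlt
        have h1 : (r - a) / T + 1 ≤ (r' - a) / T := by
          rw [← Int.add_mul_ediv_right _ _ hT.ne']
          exact Int.ediv_le_ediv hT (by linarith)
        omega
      intro r hr r' hr' he
      rcases lt_trichotomy r r' with h | h | h
      · exact absurd he (key r hr r' hr' h)
      · exact h
      · exact absurd he.symm (key r' hr' r hr h)
  simpa using this

/-- Total weight of the jobs preceding the last one in a pattern of releases `ρ, ρ + T, …`: one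
carry-over job of weight at most `f ρ` and `j` further jobs of weight at most `c`. -/
theorem sum_le_of_separated {T : ℤ} (hT : 0 < T) {R : Finset ℤ} {w f : ℤ → ℝ} {c : ℝ} (hc : 0 ≤ c)
    {ρ : ℤ} {j : ℕ} (hsep : ∀ r ∈ R, ∀ r' ∈ R, r < r' → r + T ≤ r')
    (hlow : ∀ r ∈ R, -T < r) (hhigh : ∀ r ∈ R, r ≤ ρ + j * T) (hρ0 : ρ ≤ 0) (hf : 0 ≤ f ρ)
    (hpos : ∀ r ∈ R, 0 < r → w r ≤ c) (hneg : ∀ r ∈ R, r ≤ 0 → r ≤ ρ → w r ≤ f ρ)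
    (hneg' : ∀ r ∈ R, r ≤ 0 → 1 ≤ j → w r ≤ c) : ∑ r ∈ R, w r ≤ f ρ + j * c := by
  by_cases h : ∃ r₀ ∈ R, r₀ ≤ ρ
  · obtain ⟨r₀, hr₀, hle⟩ := h
    have hlow₀ := hlow r₀ hr₀
    have hall : ∀ r ∈ R.erase r₀, 0 < r := by
      intro r hr
      obtain ⟨hne, hr⟩ := Finset.mem_erase.1 hr
      rcases lt_or_gt_of_ne hne with h | h
      · have := hsep r hr r₀ hr₀ h
        have := hlow r hr
        omega
      · have := hsep r₀ hr₀ r hr h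
        omega
    have hcard : (R.erase r₀).card ≤ j := by
      refine card_le_of_separated hT (a := 1) ?_ (fun r hr => hall r hr) ?_
      · exact fun r hr r' hr' =>
          hsep r (Finset.mem_of_mem_erase hr) r' (Finset.mem_of_mem_erase hr')
      · intro r hr
        have := hhigh r (Finset.mem_of_mem_erase hr)
        omega
    rw [← Finset.add_sum_erase _ _ hr₀]
    refine add_le_add (hneg r₀ hr₀ (by omega) hle) ?_
    calc ∑ r ∈ R.erase r₀, w r ≤ (R.erase r₀).card • c :=
          Finset.sum_le_card_nsmul _ _ _
            (fun r hr => hpos r (Finset.mem_of_mem_erase hr) (hall r hr))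
      _ ≤ j * c := by
          rw [nsmul_eq_mul]
          exact mul_le_mul_of_nonneg_right (by exact_mod_cast hcard) hc
  · push Not at h
    have hcard : R.card ≤ j := by
      refine card_le_of_separated hT (a := ρ + 1) hsep (fun r hr => h r hr) ?_
      intro r hr
      have := hhigh r hr
      omega
    have hw : ∀ r ∈ R, w r ≤ c := by
      intro r hr
      rcases le_or_gt r 0 with h0 | h0
      · exact hneg' r hr h0 (le_trans (Finset.card_pos.2 ⟨r, hr⟩) hcard)
      · exact hpos r hr h0
    calc ∑ r ∈ R, w r ≤ R.card • c := Finset.sum_le_card_nsmul _ _ _ hw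
      _ ≤ j * c := by
          rw [nsmul_eq_mul]
          exact mul_le_mul_of_nonneg_right (by exact_mod_cast hcard) hc
      _ ≤ f ρ + j * c := by linarith

/-- Every integer is `ρ + j T` with `-T < ρ ≤ 0`. -/
theorem exists_residue {T y : ℤ} (hT : 0 < T) (hy : -T < y) :
    ∃ ρ : ℤ, -T < ρ ∧ ρ ≤ 0 ∧ ∃ j : ℕ, y = ρ + j * T := by
  refine ⟨-((-y) % T), ?_, ?_, ((-((-y) / T)).toNat), ?_⟩
  · have := Int.emod_lt_of_pos (-y) hT
    omega
  · have := Int.emod_nonneg (-y) hT.ne'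
    omega
  · have h1 : (-y) / T ≤ 0 := by
      have : (-y) / T < 1 := Int.ediv_lt_of_lt_mul hT (by omega)
      omega
    have h2 := Int.emod_add_mul_ediv (-y) T
    rw [Int.toNat_of_nonneg (by omega)]
    linarith

/-- The jobs released by time `S` weigh no more than a pattern `ρ, ρ + T, …, y` of jobs released as
densely as possible with `S - T < y ≤ S`. The functions `f` and `g` bound the weight of the first
and of the last job of a pattern, and `c` bounds that of any other job.
If `tight` holds, `y` is an actual release or as early as possible, so that the first release
after `S` is no earlier than `y + T`. -/
theorem exists_pattern {T S : ℤ} (hT : 0 < T) (hS : 1 ≤ S) {R : Finset ℤ} {w f g : ℤ → ℝ} {c : ℝ}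
    (hc : 0 ≤ c) (hsep : ∀ r ∈ R, ∀ r' ∈ R, r < r' → r + T ≤ r')
    (hlow : ∀ r ∈ R, -T < r) (hRS : ∀ r ∈ R, r ≤ S)
    (hf : ∀ ρ, -T < ρ → ρ ≤ 0 → 0 ≤ f ρ) (hg : ∀ y, 0 < y → y ≤ S → 0 ≤ g y)
    (hwf : ∀ r ∈ R, r ≤ 0 → w r ≤ f r) (hwg : ∀ r ∈ R, 0 < r → w r ≤ g r)
    (hwc : ∀ r ∈ R, 0 < r → r + T ≤ S → w r ≤ c)
    (hfmono : ∀ r ρ, r ≤ ρ → ρ ≤ 0 → ρ + T ≤ S → f r ≤ f ρ)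
    (hfc : ∀ r, r ≤ 0 → T < S → f r ≤ c) (tight : Prop)
    (htight : tight → ∀ r ∈ R, r + T ≤ S → (S - T + 1 ≤ 0 → w r ≤ f (S - T + 1)) ∧
      (0 < S - T + 1 → w r ≤ g (S - T + 1))) :
    ∃ ρ : ℤ, -T < ρ ∧ ρ ≤ 0 ∧ ∃ j : ℕ, S - T < ρ + j * T ∧ ρ + j * T ≤ S ∧
      (tight → ρ + j * T ≤ S - T + 1 ∨ ρ + j * T ∈ R) ∧
      ∑ r ∈ R, w r ≤ if j = 0 then f ρ else f ρ + ((j : ℝ) - 1) * c + g (ρ + j * T) := by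
  -- it suffices to find `y` and to split off the weight `W` of the last job
  suffices H : ∃ y : ℤ, S - T < y ∧ y ≤ S ∧ (tight → y ≤ S - T + 1 ∨ y ∈ R) ∧
      ∃ R' ⊆ R, ∃ W : ℝ, ∑ r ∈ R, w r ≤ ∑ r ∈ R', w r + W ∧ (∀ r ∈ R', r + T ≤ y) ∧
        (y ≤ 0 → W ≤ f y) ∧ (0 < y → W ≤ g y) by
    obtain ⟨y, hy1, hy2, hyt, R', hR', W, hsum, hlast, hWf, hWg⟩ := H
    obtain ⟨ρ, hρ, hρ0, j, rfl⟩ := exists_residue hT (show -T < y by omega)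
    refine ⟨ρ, hρ, hρ0, j, hy1, hy2, hyt, hsum.trans ?_⟩
    rcases j with _ | j
    · have hemp : R' = ∅ := by
        refine Finset.eq_empty_of_forall_notMem fun r hr => ?_
        have h1 := hlast r hr
        have h2 := hlow r (hR' hr)
        simp only [Nat.cast_zero, zero_mul, add_zero] at h1
        omega
      simpa [hemp] using hWf (by simpa using hρ0)
    · have hy0 : 0 < ρ + ((j + 1 : ℕ) : ℤ) * T := by
        push_cast
        have : 0 ≤ (j : ℤ) * T := by positivity
        linarith
      have hyy : ρ + ((j + 1 : ℕ) : ℤ) * T = ρ + j * T + T := by push_cast; ring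
      have := sum_le_of_separated hT (w := w) (f := f) (c := c) hc (R := R') (ρ := ρ) (j := j)
        (fun r hr r' hr' => hsep r (hR' hr) r' (hR' hr')) (fun r hr => hlow r (hR' hr))
        (fun r hr => by have := hlast r hr; linarith) hρ0 (hf ρ hρ hρ0)
        (fun r hr h0 => hwc r (hR' hr) h0 ((hlast r hr).trans hy2))
        (fun r hr h0 h1 => (hwf r (hR' hr) h0).trans (hfmono r ρ h1 hρ0 (by
          have : 0 ≤ (j : ℤ) * T := by positivity
          linarith)))
        (fun r hr h0 h1 => (hwf r (hR' hr) h0).trans (hfc r h0 (by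
          have : T ≤ (j : ℤ) * T := by
            have : (1 : ℤ) ≤ j := by exact_mod_cast h1
            nlinarith
          linarith)))
      have h2 := hWg hy0
      simp only [Nat.add_eq_zero_iff, one_ne_zero, and_false, if_false]
      push_cast at *
      linarith
  by_cases hne : R.Nonempty
  swap
  · rw [Finset.not_nonempty_iff_eq_empty] at hne
    refine ⟨S - T + 1, by omega, by omega, fun _ => Or.inl le_rfl, ∅, by simp, 0, by simp [hne],
      by simp, fun h => hf _ (by omega) h, fun h => hg _ h (by omega)⟩
  obtain ⟨y₀, hy₀, hmax⟩ : ∃ y₀ ∈ R, ∀ r ∈ R, r ≤ y₀ :=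
    ⟨R.max' hne, R.max'_mem hne, fun r hr => R.le_max' r hr⟩
  have herase : ∀ r ∈ R.erase y₀, r + T ≤ y₀ := fun r hr =>
    hsep r (Finset.mem_of_mem_erase hr) y₀ hy₀
      (lt_of_le_of_ne (hmax r (Finset.mem_of_mem_erase hr)) (Finset.ne_of_mem_erase hr))
  rcases lt_or_ge S (y₀ + T) with hlt | hge
  · exact ⟨y₀, by omega, hRS _ hy₀, fun _ => Or.inr hy₀, R.erase y₀, Finset.erase_subset _ _,
      w y₀, (Finset.sum_erase_add _ _ hy₀).ge, herase, hwf y₀ hy₀, hwg y₀ hy₀⟩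
  by_cases ht : tight
  · exact ⟨S - T + 1, by omega, by omega, fun _ => Or.inl le_rfl, R.erase y₀,
      Finset.erase_subset _ _, w y₀, (Finset.sum_erase_add _ _ hy₀).ge,
      fun r hr => by have := herase r hr; omega, (htight ht y₀ hy₀ hge).1,
      (htight ht y₀ hy₀ hge).2⟩
  · have h1 := Int.emod_lt_of_pos (S - y₀) hT
    have h2 := Int.emod_nonneg (S - y₀) hT.ne'
    have h3 := Int.emod_add_mul_ediv (S - y₀) T
    have h4 : 1 ≤ (S - y₀) / T := by
      rw [Int.le_ediv_iff_mul_le hT]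
      omega
    have h5 : T ≤ T * ((S - y₀) / T) := by nlinarith
    have h6 := hlow y₀ hy₀
    exact ⟨y₀ + T * ((S - y₀) / T), by linarith, by linarith, fun h => absurd h ht, R, subset_rfl,
      0, by simp, fun r hr => by have := hmax r hr; linarith, fun h => by linarith,
      fun h => hg _ h (by linarith)⟩

/-! ### Demand of a single task -/

namespace MCTask

variable (t : MCTask)

theorem C_le_succ {m : ℕ} (h : m + 1 ≤ t.L) : t.C m ≤ t.C (m + 1) := by
  rcases Nat.eq_zero_or_pos m with rfl | hm
  · simp [t.C_zero]
  · exact t.C_mono m hm h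

theorem V_le_succ {m : ℕ} (h : m + 1 ≤ t.L) : t.V m ≤ t.V (m + 1) := by
  rcases Nat.eq_zero_or_pos m with rfl | hm
  · simp [t.V_zero]
  · exact t.V_mono m hm h

theorem C_le_of_le {m m' : ℕ} (h : m ≤ m') (h' : m' ≤ t.L) : t.C m ≤ t.C m' := by
  induction m', h using Nat.le_induction with
  | base => exact le_rfl
  | succ k _ ih => exact (ih (by omega)).trans (t.C_le_succ h')

theorem V_le_of_le {m m' : ℕ} (h : m ≤ m') (h' : m' ≤ t.L) : t.V m ≤ t.V m' := by
  induction m', h using Nat.le_induction with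
  | base => exact le_rfl
  | succ k _ ih => exact (ih (by omega)).trans (t.V_le_succ h')

theorem C_pos {m : ℕ} (hm : 1 ≤ m) (h : m ≤ t.L) : 1 ≤ t.C m :=
  t.one_le_C.trans (t.C_le_of_le hm h)

theorem V_pos {m : ℕ} (hm : 1 ≤ m) (h : m ≤ t.L) : 1 ≤ t.V m :=
  t.one_le_V.trans (t.V_le_of_le hm h)

theorem V_le_D_of_le {m : ℕ} (h : m ≤ t.L) : t.V m ≤ t.D := (t.V_le_of_le h le_rfl).trans t.V_le_D

theorem V_le_T {m : ℕ} (h : m ≤ t.L) : t.V m ≤ t.T := (t.V_le_D_of_le h).trans t.D_le_T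

theorem C_le_T {m : ℕ} (h : m ≤ t.L) : t.C m ≤ t.T :=
  (t.C_le_of_le h le_rfl).trans (t.C_le_D.trans t.D_le_T)

theorem one_le_D : 1 ≤ t.D := (t.C_pos t.one_le_L le_rfl).trans t.C_le_D

theorem T_pos : 0 < t.T := t.one_le_D.trans t.D_le_T

/-! The demand functions at level `k + 2`, free of truncated subtraction. -/

theorem demandA_eq (k : ℕ) (S e r : ℤ) : t.demandA (k + 2) S e r =
    if ¬ (r + t.V k < 0) ∧ r + t.V (k + 1) ≤ e then
      min (min (r + t.V k) (t.C k) + t.C (k + 1) - t.C k) S else 0 := rfl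

theorem demandB_eq (k : ℕ) (S e r : ℤ) : t.demandB (k + 2) S e r =
    if r + t.V (k + 1) ≤ e then min (t.C (k + 1) : ℤ) (S - r) else 0 := rfl

theorem demandC_eq (k : ℕ) (S e r : ℤ) : t.demandC (k + 2) S e r =
    if r + t.V k < 0 ∨ ¬ (r + t.V (k + 1) ≤ e) then 0
    else if r + t.V (k + 1) < S then t.C (k + 1) - t.C k + min (r + t.V k) (t.C k)
    else if r + t.V (k + 2) ≤ e then t.C (k + 2) - t.C k + min (r + t.V k) (t.C k)
    else min S (t.C (k + 1) - t.C k + min (r + t.V k) (t.C k)) := rfl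

theorem demandD_eq (k : ℕ) (S e r : ℤ) : t.demandD (k + 2) S e r =
    if ¬ (r + t.V (k + 1) ≤ e) then 0
    else if r + t.V (k + 1) < S then (t.C (k + 1) : ℤ)
    else if r + t.V (k + 2) ≤ e then (t.C (k + 2) : ℤ)
    else min (t.C (k + 1) : ℤ) (S - r) := rfl

variable {t}

section high

variable {k : ℕ} {S e : ℤ}

theorem demandC_nonneg (hk : k + 2 ≤ t.L) (hS : 1 ≤ S) (r : ℤ) : 0 ≤ t.demandC (k + 2) S e r := by
  have h1 := t.C_le_succ (m := k) (by omega)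
  have h2 : t.C (k + 1) ≤ t.C (k + 2) := t.C_le_succ hk
  rw [demandC_eq]
  split_ifs <;> omega

theorem demandD_nonneg {r : ℤ} (hr : r ≤ S) : 0 ≤ t.demandD (k + 2) S e r := by
  rw [demandD_eq]
  split_ifs <;> omega

theorem demandC_mono (hk : k + 2 ≤ t.L) {r ρ : ℤ} (h : r ≤ ρ)
    (hρ : ρ + t.V (k + 2) ≤ e) : t.demandC (k + 2) S e r ≤ t.demandC (k + 2) S e ρ := by
  have h1 := t.C_le_succ (m := k) (by omega)
  have h2 : t.C (k + 1) ≤ t.C (k + 2) := t.C_le_succ hk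
  have h3 : t.V (k + 1) ≤ t.V (k + 2) := t.V_le_succ hk
  rw [demandC_eq, demandC_eq]
  split_ifs <;> omega

theorem demandC_le_demandD (hk : k + 2 ≤ t.L) {r y : ℤ} (h : r ≤ y)
    (hy : y + t.V (k + 2) ≤ e) : t.demandC (k + 2) S e r ≤ t.demandD (k + 2) S e y := by
  have h1 := t.C_le_succ (m := k) (by omega)
  have h2 : t.C (k + 1) ≤ t.C (k + 2) := t.C_le_succ hk
  have h3 : t.V (k + 1) ≤ t.V (k + 2) := t.V_le_succ hk
  rw [demandC_eq, demandD_eq]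
  split_ifs <;> omega

theorem demandC_le (hk : k + 2 ≤ t.L) {r : ℤ} (hr : r ≤ 0) (hS : (t.T : ℤ) < S) :
    t.demandC (k + 2) S e r ≤ t.C (k + 1) := by
  have h1 := t.C_le_succ (m := k) (by omega)
  have h3 := t.V_le_T (m := k + 1) (by omega)
  rw [demandC_eq]
  split_ifs <;> omega

theorem C_le_demandD (hk : k + 2 ≤ t.L) {y : ℤ} (hy : y + t.V (k + 2) ≤ e) :
    t.C (k + 1) ≤ t.demandD (k + 2) S e y := by
  have h2 : t.C (k + 1) ≤ t.C (k + 2) := t.C_le_succ hk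
  have h3 : t.V (k + 1) ≤ t.V (k + 2) := t.V_le_succ hk
  rw [demandD_eq]
  split_ifs <;> omega

theorem demHigh_of_lt {ρ : ℤ} (h : S < ρ + t.T) (h0 : ρ ≤ S) :
    t.demHigh (k + 2) S e ρ = t.demandC (k + 2) S e ρ +
      max 0 ((e - (ρ + t.T) - t.V (k + 2)) / t.T + 1) * t.C (k + 2) := by
  have hT : (0 : ℤ) < t.T := by exact_mod_cast t.T_pos
  have hn : (S - ρ - t.T) / t.T = -1 := by
    apply le_antisymm
    · have : (S - ρ - t.T) / t.T < 0 := Int.ediv_lt_of_lt_mul hT (by linarith)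
      omega
    · rw [Int.le_ediv_iff_mul_le hT]
      linarith
  have : ¬ S ≥ ρ + t.T := by omega
  simp only [demHigh, hn, this, if_false]
  norm_num

theorem demHigh_of_le {ρ y : ℤ} {j : ℕ} (hy : y = ρ + ((j + 1 : ℕ) : ℤ) * t.T) (h : y ≤ S)
    (h' : S < y + t.T) : t.demHigh (k + 2) S e ρ = t.demandC (k + 2) S e ρ + j * t.C (k + 1) +
      t.demandD (k + 2) S e y +
      max 0 ((e - (y + t.T) - t.V (k + 2)) / t.T + 1) * t.C (k + 2) := by
  have hT : (0 : ℤ) < t.T := by exact_mod_cast t.T_pos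
  push_cast at hy
  have hn : (S - ρ - t.T) / t.T = j := by
    apply le_antisymm
    · have : (S - ρ - t.T) / t.T < j + 1 := Int.ediv_lt_of_lt_mul hT (by linarith)
      omega
    · rw [Int.le_ediv_iff_mul_le hT]
      linarith
  have h1 : S ≥ ρ + t.T := by nlinarith [Int.natCast_nonneg j]
  have h2 : ρ + ((j : ℤ) + 2) * t.T = y + t.T := by rw [hy]; ring
  have h3 : ρ + ((j : ℤ) + 1) * t.T = y := hy.symm
  simp only [demHigh, hn, h1, if_true, h2, h3, Nat.reduceSubDiff]

/-- A job set of a task of level at least `k + 2` weighs at most the multi-mode demand bound, if its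
jobs satisfy the bounds that define the demands of `J^C`, `J^D`, the jobs between them and those
after them. The origin is the time at which mode `k + 1` is entered. -/
theorem sum_le_dbfMM_high (hk : k + 2 ≤ t.L) (hS : 1 ≤ S) (hSe : S ≤ e) {R : Finset ℤ} {w : ℤ → ℝ}
    (hsep : ∀ r ∈ R, ∀ r' ∈ R, r < r' → r + t.T ≤ r') (hlow : ∀ r ∈ R, -(t.T : ℤ) < r)
    (hC : ∀ r ∈ R, r ≤ 0 → w r ≤ t.demandC (k + 2) S e r)
    (hD : ∀ r ∈ R, 0 < r → r ≤ S → w r ≤ t.demandD (k + 2) S e r)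
    (hmid : ∀ r ∈ R, 0 < r → r + t.T ≤ S → w r ≤ t.C (k + 1))
    (hlate : ∀ r ∈ R, S < r → r + t.V (k + 2) ≤ e → w r ≤ t.C (k + 2))
    (hlate' : ∀ r ∈ R, S < r → e < r + t.V (k + 2) → w r ≤ 0) :
    ∑ r ∈ R, w r ≤ t.dbfMM S e (k + 2) := by
  classical
  have hT : (0 : ℤ) < t.T := by exact_mod_cast t.T_pos
  have hVT : (t.V (k + 2) : ℤ) ≤ t.T := by exact_mod_cast t.V_le_T hk
  have hV1 : 1 ≤ t.V (k + 2) := t.V_pos (by omega) hk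
  set P := R.filter (· ≤ S) with hP
  set Q := R.filter (fun r => S < r ∧ r + t.V (k + 2) ≤ e) with hQ
  have hPR : ∀ r ∈ P, r ∈ R := fun r hr => (Finset.mem_filter.1 hr).1
  have hsplit : ∑ r ∈ R, w r ≤ ∑ r ∈ P, w r + Q.card * (t.C (k + 2) : ℝ) := by
    rw [← Finset.sum_filter_add_sum_filter_not R (· ≤ S)]
    gcongr
    calc ∑ r ∈ R with ¬ r ≤ S, w r
        ≤ ∑ r ∈ R with ¬ r ≤ S, if r + t.V (k + 2) ≤ e then (t.C (k + 2) : ℝ) else 0 := by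
          refine Finset.sum_le_sum fun r hr => ?_
          obtain ⟨hr, hrS⟩ := Finset.mem_filter.1 hr
          split_ifs with h
          · exact hlate r hr (by omega) h
          · exact hlate' r hr (by omega) (by omega)
      _ = Q.card * (t.C (k + 2) : ℝ) := by
          rw [← Finset.sum_filter, Finset.filter_filter, Finset.sum_const, nsmul_eq_mul, hQ]
          simp only [not_le]
  obtain ⟨ρ, hρ, hρ0, j, hy1, hy2, hy3, hsum⟩ := exists_pattern hT hS (R := P) (w := w)
    (f := fun r => (t.demandC (k + 2) S e r : ℝ)) (g := fun r => (t.demandD (k + 2) S e r : ℝ))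
    (c := t.C (k + 1)) (by positivity)
    (fun r hr r' hr' => hsep r (hPR r hr) r' (hPR r' hr')) (fun r hr => hlow r (hPR r hr))
    (fun r hr => (Finset.mem_filter.1 hr).2)
    (fun ρ _ _ => by exact_mod_cast demandC_nonneg hk hS ρ)
    (fun y _ hy => by exact_mod_cast demandD_nonneg hy)
    (fun r hr => hC r (hPR r hr))
    (fun r hr h => hD r (hPR r hr) h (Finset.mem_filter.1 hr).2)
    (fun r hr => hmid r (hPR r hr))
    (fun r ρ h _ h' => by
      have : t.demandC (k + 2) S e r ≤ t.demandC (k + 2) S e ρ := demandC_mono hk h (by omega)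
      exact_mod_cast this)
    (fun r h h' => by
      have : t.demandC (k + 2) S e r ≤ t.C (k + 1) := demandC_le hk h h'
      exact_mod_cast this)
    Q.Nonempty (by
      rintro ⟨q, hq⟩ r hr hrS
      obtain ⟨-, hq1, hq2⟩ := Finset.mem_filter.1 hq
      have hd : S - t.T + 1 + t.V (k + 2) ≤ e := by omega
      refine ⟨fun h => (hC r (hPR r hr) (by omega)).trans ?_, fun h => ?_⟩
      · exact_mod_cast demandC_mono hk (by omega) hd
      · rcases le_or_gt r 0 with h0 | h0
        · refine (hC r (hPR r hr) h0).trans ?_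
          exact_mod_cast demandC_le_demandD hk (by omega) hd
        · refine (hmid r (hPR r hr) h0 hrS).trans ?_
          exact_mod_cast C_le_demandD hk hd)
  set y := ρ + j * t.T with hy
  have hcard : (Q.card : ℤ) ≤ max 0 ((e - (y + t.T) - t.V (k + 2)) / t.T + 1) := by
    set K := (e - (y + t.T) - t.V (k + 2)) / t.T + 1 with hK
    have hKlt : e - (y + t.T) - t.V (k + 2) < K * t.T := by
      have := Int.lt_ediv_add_one_mul_self (e - (y + t.T) - t.V (k + 2)) hT
      rwa [← hK] at this
    have : Q.card ≤ K.toNat := by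
      refine card_le_of_separated hT (a := y + t.T)
        (fun r hr r' hr' => hsep r (Finset.mem_filter.1 hr).1 r' (Finset.mem_filter.1 hr').1) ?_ ?_
      · intro q hq
        obtain ⟨hqR, hq1, hq2⟩ := Finset.mem_filter.1 hq
        rcases hy3 ⟨q, hq⟩ with h | h
        · omega
        · exact hsep _ (hPR _ h) q hqR (by omega)
      · intro q hq
        obtain ⟨hqR, hq1, hq2⟩ := Finset.mem_filter.1 hq
        have : K * t.T ≤ (K.toNat : ℤ) * t.T := mul_le_mul_of_nonneg_right (Int.self_le_toNat K) hT.le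
        linarith
    omega
  have hfin : ∑ r ∈ R, w r ≤ (t.demHigh (k + 2) S e ρ : ℝ) := by
    have hQc : Q.card * (t.C (k + 2) : ℝ) ≤
        ((max 0 ((e - (y + t.T) - t.V (k + 2)) / t.T + 1) : ℤ) : ℝ) * t.C (k + 2) :=
      mul_le_mul_of_nonneg_right (by exact_mod_cast hcard) (by positivity)
    rcases j with _ | j
    · have hyρ : y = ρ := by simp [hy]
      rw [hyρ] at hQc hy1
      rw [if_pos rfl] at hsum
      rw [demHigh_of_lt (by omega) (by omega)]
      push_cast at *
      linarith
    · rw [if_neg (by omega)] at hsum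
      rw [demHigh_of_le hy hy2 (by omega)]
      push_cast at *
      linarith
  refine hfin.trans ?_
  rw [dbfMM, if_neg (by omega), if_neg (by omega), if_neg (by omega)]
  exact_mod_cast Finset.le_sup' (t.demHigh (k + 2) S e) (Finset.mem_Icc.2 ⟨hρ.le, hρ0⟩)

end high

section low

variable {k : ℕ} {S e : ℤ}

theorem demandA_nonneg (hk : k + 1 ≤ t.L) (hS : 1 ≤ S) (r : ℤ) : 0 ≤ t.demandA (k + 2) S e r := by
  have h1 := t.C_le_succ (m := k) (by omega)
  rw [demandA_eq]
  split_ifs <;> omega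

theorem demandB_nonneg {r : ℤ} (hr : r ≤ S) : 0 ≤ t.demandB (k + 2) S e r := by
  rw [demandB_eq]
  split_ifs <;> omega

theorem demLow_of_lt {ρ : ℤ} (h : S < ρ + t.T) :
    t.demLow (k + 2) S e ρ = t.demandA (k + 2) S e ρ := by
  rw [demLow, if_pos h]

theorem demLow_of_le {ρ y : ℤ} {j : ℕ} (hy : y = ρ + ((j + 1 : ℕ) : ℤ) * t.T) (h : y ≤ S)
    (h' : S < y + t.T) : t.demLow (k + 2) S e ρ = t.demandA (k + 2) S e ρ + j * t.C (k + 1) +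
      t.demandB (k + 2) S e y := by
  have hT : (0 : ℤ) < t.T := by exact_mod_cast t.T_pos
  push_cast at hy
  have hn : (S - (ρ + t.T)) / t.T = j := by
    apply le_antisymm
    · have : (S - (ρ + t.T)) / t.T < j + 1 := Int.ediv_lt_of_lt_mul hT (by linarith)
      omega
    · rw [Int.le_ediv_iff_mul_le hT]
      linarith
  have h1 : ¬ ρ + t.T > S := by nlinarith [Int.natCast_nonneg j]
  have h3 : ρ + ((j : ℤ) + 1) * t.T = y := hy.symm
  simp only [demLow, hn, h1, if_false, h3, Nat.reduceSubDiff]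

/-- The analogue of `sum_le_dbfMM_high` for a task of level `k + 1`. -/
theorem sum_le_dbfMM_low (hk : t.L = k + 1) (hS : 1 ≤ S) (hSe : S ≤ e) {R : Finset ℤ} {w : ℤ → ℝ}
    (hsep : ∀ r ∈ R, ∀ r' ∈ R, r < r' → r + t.T ≤ r') (hlow : ∀ r ∈ R, -(t.T : ℤ) < r)
    (hA : ∀ r ∈ R, r ≤ 0 → w r ≤ t.demandA (k + 2) S e r)
    (hB : ∀ r ∈ R, 0 < r → r ≤ S → w r ≤ t.demandB (k + 2) S e r)
    (hlate : ∀ r ∈ R, S < r → w r ≤ 0) :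
    ∑ r ∈ R, w r ≤ t.dbfMM S e (k + 2) := by
  classical
  have hT : (0 : ℤ) < t.T := by exact_mod_cast t.T_pos
  have hVT : (t.V (k + 1) : ℤ) ≤ t.T := by exact_mod_cast t.V_le_T hk.ge
  have hVV : (t.V k : ℤ) ≤ t.V (k + 1) := by exact_mod_cast t.V_le_succ hk.ge
  have hCC : (t.C k : ℤ) ≤ t.C (k + 1) := by exact_mod_cast t.C_le_succ hk.ge
  set P := R.filter (· ≤ S) with hP
  have hPR : ∀ r ∈ P, r ∈ R := fun r hr => (Finset.mem_filter.1 hr).1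
  have hsplit : ∑ r ∈ R, w r ≤ ∑ r ∈ P, w r := by
    rw [← Finset.sum_filter_add_sum_filter_not R (· ≤ S)]
    have : ∑ r ∈ R with ¬ r ≤ S, w r ≤ 0 := by
      refine Finset.sum_nonpos fun r hr => ?_
      obtain ⟨hr, hrS⟩ := Finset.mem_filter.1 hr
      exact hlate r hr (by omega)
    linarith
  obtain ⟨ρ, hρ, hρ0, j, hy1, hy2, -, hsum⟩ := exists_pattern hT hS (R := P) (w := w)
    (f := fun r => (t.demandA (k + 2) S e r : ℝ)) (g := fun r => (t.demandB (k + 2) S e r : ℝ))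
    (c := t.C (k + 1)) (by positivity)
    (fun r hr r' hr' => hsep r (hPR r hr) r' (hPR r' hr')) (fun r hr => hlow r (hPR r hr))
    (fun r hr => (Finset.mem_filter.1 hr).2)
    (fun ρ _ _ => by exact_mod_cast demandA_nonneg hk.ge hS ρ)
    (fun y _ hy => by exact_mod_cast demandB_nonneg hy)
    (fun r hr => hA r (hPR r hr))
    (fun r hr h => hB r (hPR r hr) h (Finset.mem_filter.1 hr).2)
    (fun r hr h0 h1 => by
      refine (hB r (hPR r hr) h0 (by omega)).trans ?_
      have : t.demandB (k + 2) S e r ≤ t.C (k + 1) := by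
        rw [demandB_eq]; split_ifs <;> omega
      exact_mod_cast this)
    (fun r ρ h _ h' => by
      have : t.demandA (k + 2) S e r ≤ t.demandA (k + 2) S e ρ := by
        rw [demandA_eq, demandA_eq]; split_ifs <;> omega
      exact_mod_cast this)
    (fun r h h' => by
      have : t.demandA (k + 2) S e r ≤ t.C (k + 1) := by
        rw [demandA_eq]; split_ifs <;> omega
      exact_mod_cast this)
    False (fun h => h.elim)
  have hfin : ∑ r ∈ R, w r ≤ (t.demLow (k + 2) S e ρ : ℝ) := by
    rcases j with _ | j
    · simp only [Nat.cast_zero, zero_mul, add_zero] at hy1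
      rw [if_pos rfl] at hsum
      rw [demLow_of_lt (by omega)]
      linarith
    · rw [if_neg (by omega)] at hsum
      rw [demLow_of_le rfl hy2 (by omega)]
      push_cast at *
      linarith
  refine hfin.trans ?_
  rw [dbfMM, if_neg (by omega), if_neg (by omega), if_pos (by omega)]
  exact_mod_cast Finset.le_sup' (t.demLow (k + 2) S e) (Finset.mem_Icc.2 ⟨hρ.le, hρ0⟩)

end low

/-- The analogue of `sum_le_dbfMM_high` for mode `1`. -/
theorem sum_le_dbfMM_one {S e : ℤ} (he : 0 ≤ e) {R : Finset ℤ} {w : ℤ → ℝ}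
    (hsep : ∀ r ∈ R, ∀ r' ∈ R, r < r' → r + t.T ≤ r') (hlow : ∀ r ∈ R, 0 ≤ r)
    (hw : ∀ r ∈ R, r + t.V 1 ≤ e → w r ≤ t.C 1) (hw' : ∀ r ∈ R, e < r + t.V 1 → w r ≤ 0) :
    ∑ r ∈ R, w r ≤ t.dbfMM S e 1 := by
  classical
  have hT : (0 : ℤ) < t.T := by exact_mod_cast t.T_pos
  have hVT : (t.V 1 : ℤ) ≤ t.T := by exact_mod_cast t.V_le_T t.one_le_L
  set K := (e - t.V 1) / t.T + 1 with hK
  have hK0 : 0 ≤ K := by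
    have : -1 ≤ (e - t.V 1) / t.T := by
      rw [Int.le_ediv_iff_mul_le hT]
      linarith
    omega
  have hKlt : e - t.V 1 < K * t.T := Int.lt_ediv_add_one_mul_self (e - t.V 1) hT
  have hcard : (R.filter (fun r => r + t.V 1 ≤ e)).card ≤ K.toNat := by
    refine card_le_of_separated hT (a := 0)
      (fun r hr r' hr' => hsep r (Finset.mem_filter.1 hr).1 r' (Finset.mem_filter.1 hr').1)
      (fun r hr => hlow r (Finset.mem_filter.1 hr).1) (fun r hr => ?_)
    have := (Finset.mem_filter.1 hr).2
    rw [Int.toNat_of_nonneg hK0]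
    linarith
  have hcard' : ((R.filter (fun r => r + t.V 1 ≤ e)).card : ℤ) ≤ K := by omega
  calc ∑ r ∈ R, w r ≤ ∑ r ∈ R, if r + t.V 1 ≤ e then (t.C 1 : ℝ) else 0 := by
        refine Finset.sum_le_sum fun r hr => ?_
        split_ifs with h
        · exact hw r hr h
        · exact hw' r hr (by omega)
    _ = (R.filter (fun r => r + t.V 1 ≤ e)).card * (t.C 1 : ℝ) := by
        rw [← Finset.sum_filter, Finset.sum_const, nsmul_eq_mul]
    _ ≤ (K : ℝ) * t.C 1 := mul_le_mul_of_nonneg_right (by exact_mod_cast hcard') (by positivity)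
    _ = t.dbfMM S e 1 := by simp [dbfMM, hK]

end MCTask

/-! ### Linear growth of the demand bound -/

namespace MCTask

variable {t : MCTask} {k : ℕ} {S e : ℤ}

theorem demandC_le_T (hk : k + 2 ≤ t.L) (r : ℤ) : t.demandC (k + 2) S e r ≤ t.T := by
  have h1 := t.C_le_succ (m := k) (by omega)
  have h2 : t.C (k + 1) ≤ t.C (k + 2) := t.C_le_succ hk
  have h3 := t.C_le_T hk
  rw [demandC_eq]
  split_ifs <;> omega

theorem demandD_le_T (hk : k + 2 ≤ t.L) (r : ℤ) : t.demandD (k + 2) S e r ≤ t.T := by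
  have h2 : t.C (k + 1) ≤ t.C (k + 2) := t.C_le_succ hk
  have h3 := t.C_le_T hk
  rw [demandD_eq]
  split_ifs <;> omega

theorem demHigh_le (hk : k + 2 ≤ t.L) (hS : 1 ≤ S) (hSe : S ≤ e) {r : ℤ} (hr : -(t.T : ℤ) ≤ r) :
    (t.demHigh (k + 2) S e r : ℝ) ≤
      S * ((t.C (k + 1) : ℝ) / t.T) + (e - S) * ((t.C (k + 2) : ℝ) / t.T) + 3 * t.T := by
  have hT : (0 : ℤ) < t.T := by exact_mod_cast t.T_pos
  have hT' : (0 : ℝ) < t.T := by exact_mod_cast t.T_pos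
  have hC : (t.demandC (k + 2) S e r : ℝ) ≤ t.T := by exact_mod_cast demandC_le_T hk r
  have hCT : (t.C (k + 2) : ℝ) ≤ t.T := by exact_mod_cast t.C_le_T hk
  set n := (S - r - t.T) / t.T with hn
  have hn1 : n * t.T ≤ S - r - t.T := Int.ediv_mul_le _ hT.ne'
  have hn2 : S - r - t.T < (n + 1) * t.T := Int.lt_ediv_add_one_mul_self _ hT
  set K := (e - (r + (n + 2) * t.T) - t.V (k + 2)) / (t.T : ℤ) + 1 with hK
  have hK1 : (K - 1) * t.T ≤ e - (r + (n + 2) * t.T) - t.V (k + 2) := by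
    rw [hK, add_sub_cancel_right]
    exact Int.ediv_mul_le _ hT.ne'
  have hK2 : (K - 1) * t.T ≤ e - S := by
    have : (0 : ℤ) ≤ t.V (k + 2) := by positivity
    nlinarith
  have hk' : ((max 0 K : ℤ) : ℝ) * t.C (k + 2) ≤
      (e - S) * ((t.C (k + 2) : ℝ) / t.T) + t.T := by
    have h1 : ((max 0 K : ℤ) : ℝ) ≤ (e - S) / t.T + 1 := by
      have hSe' : (S : ℝ) ≤ e := by exact_mod_cast hSe
      rw [Int.cast_max, max_le_iff]
      constructor
      · have : (0 : ℝ) ≤ (e - S) / t.T := div_nonneg (by linarith) hT'.le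
        push_cast
        linarith
      · rw [← sub_le_iff_le_add, le_div_iff₀ hT']
        exact_mod_cast hK2
    calc ((max 0 K : ℤ) : ℝ) * t.C (k + 2) ≤ ((e - S) / t.T + 1) * t.C (k + 2) :=
          mul_le_mul_of_nonneg_right h1 (by positivity)
      _ = (e - S) * ((t.C (k + 2) : ℝ) / t.T) + t.C (k + 2) := by ring
      _ ≤ _ := by linarith
  have hn' : (n : ℝ) * t.C (k + 1) ≤ S * ((t.C (k + 1) : ℝ) / t.T) := by
    have h1 : (n : ℝ) ≤ S / t.T := by
      rw [le_div_iff₀ hT']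
      have : n * t.T ≤ S := by linarith
      exact_mod_cast this
    calc (n : ℝ) * t.C (k + 1) ≤ S / t.T * t.C (k + 1) :=
          mul_le_mul_of_nonneg_right h1 (by positivity)
      _ = _ := by ring
  have hS0 : 0 ≤ S * ((t.C (k + 1) : ℝ) / t.T) :=
    mul_nonneg (by exact_mod_cast (by omega : 0 ≤ S)) (by positivity)
  simp only [demHigh, Nat.reduceSubDiff, ← hn, ← hK]
  split_ifs
  · have hD : (t.demandD (k + 2) S e (r + (n + 1) * t.T) : ℝ) ≤ t.T := by
      exact_mod_cast demandD_le_T hk _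
    push_cast at *
    linarith
  · push_cast at *
    linarith

theorem demLow_le (hk : t.L = k + 1) (hS : 1 ≤ S) {r : ℤ} (hr : -(t.T : ℤ) ≤ r) :
    (t.demLow (k + 2) S e r : ℝ) ≤ S * ((t.C (k + 1) : ℝ) / t.T) + 3 * t.T := by
  have hT : (0 : ℤ) < t.T := by exact_mod_cast t.T_pos
  have hT' : (0 : ℝ) < t.T := by exact_mod_cast t.T_pos
  have hCC := t.C_le_succ hk.ge
  have hCT := t.C_le_T hk.ge
  have hA : (t.demandA (k + 2) S e r : ℝ) ≤ t.T := by
    have : t.demandA (k + 2) S e r ≤ t.T := by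
      rw [demandA_eq]; split_ifs <;> omega
    exact_mod_cast this
  set n := (S - (r + t.T)) / t.T with hn
  have hn1 : n * t.T ≤ S - (r + t.T) := Int.ediv_mul_le _ hT.ne'
  have hn' : (n : ℝ) * t.C (k + 1) ≤ S * ((t.C (k + 1) : ℝ) / t.T) := by
    have h1 : (n : ℝ) ≤ S / t.T := by
      rw [le_div_iff₀ hT']
      have : n * t.T ≤ S := by linarith
      exact_mod_cast this
    calc (n : ℝ) * t.C (k + 1) ≤ S / t.T * t.C (k + 1) :=
          mul_le_mul_of_nonneg_right h1 (by positivity)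
      _ = _ := by ring
  have hS0 : 0 ≤ S * ((t.C (k + 1) : ℝ) / t.T) :=
    mul_nonneg (by exact_mod_cast (by omega : 0 ≤ S)) (by positivity)
  simp only [demLow, Nat.reduceSubDiff, ← hn]
  split_ifs
  · linarith
  · have hB : (t.demandB (k + 2) S e (r + (n + 1) * t.T) : ℝ) ≤ t.T := by
      have : t.demandB (k + 2) S e (r + (n + 1) * t.T) ≤ t.T := by
        rw [demandB_eq]; split_ifs <;> omega
      exact_mod_cast this
    push_cast at *
    linarith

/-- Up to a constant, the demand in `[0, e)` of a task is the one at the level-`(k + 1)` rate before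
the mode switch at `S` and at the level-`(k + 2)` rate after it. -/
theorem dbfMM_le (hk : k + 1 ≤ t.L) (hS : 1 ≤ S) (hSe : S ≤ e) : (t.dbfMM S e (k + 2) : ℝ) ≤
    S * ((t.C (k + 1) : ℝ) / t.T) + (e - S) * (if k + 2 ≤ t.L then (t.C (k + 2) : ℝ) / t.T else 0)
      + 3 * t.T := by
  rw [dbfMM, if_neg (by omega), if_neg (by omega)]
  split_ifs with h1 h2 h2
  · omega
  · obtain ⟨r, hr, he⟩ := Finset.exists_mem_eq_sup' (⟨0, by simp⟩ : (Finset.Icc (-(t.T : ℤ)) 0).Nonempty)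
      (t.demLow (k + 2) S e)
    rw [he, mul_zero, add_zero]
    exact demLow_le (by omega) hS (Finset.mem_Icc.1 hr).1
  · obtain ⟨r, hr, he⟩ := Finset.exists_mem_eq_sup' (⟨0, by simp⟩ : (Finset.Icc (-(t.T : ℤ)) 0).Nonempty)
      (t.demHigh (k + 2) S e)
    rw [he]
    exact demHigh_le h2 hS hSe (Finset.mem_Icc.1 hr).1
  · omega

theorem dbfMM_one_le : (t.dbfMM S e 1 : ℝ) ≤ e * ((t.C 1 : ℝ) / t.T) + 3 * t.T := by
  have hT : (0 : ℤ) < t.T := by exact_mod_cast t.T_pos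
  have hT' : (0 : ℝ) < t.T := by exact_mod_cast t.T_pos
  have hCT : (t.C 1 : ℝ) ≤ t.T := by exact_mod_cast t.C_le_T t.one_le_L
  have h1 : (((e - t.V 1) / t.T : ℤ) : ℝ) ≤ e / t.T := by
    rw [le_div_iff₀ hT']
    have : (e - t.V 1) / t.T * t.T ≤ e :=
      (Int.ediv_mul_le _ hT.ne').trans (by have : (0 : ℤ) ≤ t.V 1 := by positivity
                                           linarith)
    exact_mod_cast this
  have h2 := mul_le_mul_of_nonneg_right h1 (show (0 : ℝ) ≤ t.C 1 by positivity)
  have h3 : (e : ℝ) / t.T * t.C 1 = e * ((t.C 1 : ℝ) / t.T) := by ring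
  simp only [dbfMM, if_true]
  push_cast
  linarith

end MCTask

namespace MCTaskSet

variable {n : ℕ} {τ : Fin n → MCTask}

theorem le_maxLevel (τ : Fin n → MCTask) (i : Fin n) : (τ i).L ≤ maxLevel τ :=
  Finset.le_sup (f := fun i => (τ i).L) (Finset.mem_univ i)

theorem sum_T_le_unarySize (τ : Fin n → MCTask) : ∑ i, ((τ i).T : ℝ) ≤ unarySize τ := by
  rw [unarySize]
  push_cast
  refine Finset.sum_le_sum fun i _ => ?_
  have : (0 : ℝ) ≤ ∑ m ∈ Finset.Icc 1 (τ i).L, (((τ i).C m : ℝ) + (τ i).V m) := by positivity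
  have h2 : (0 : ℝ) ≤ (τ i).L := by positivity
  have h3 : (0 : ℝ) ≤ (τ i).D := by positivity
  linarith

theorem dbfMM_le {c : ℝ} (hc : ∀ m, 1 ≤ m → m ≤ maxLevel τ → utilization τ m ≤ c) {m : ℕ}
    (hm : 1 ≤ m) (hmM : m ≤ maxLevel τ) {S e : ℤ} (hS : 1 ≤ S) (hSe : S ≤ e) :
    (dbfMM τ S e m : ℝ) ≤ c * e + 3 * unarySize τ := by
  have hsz := sum_T_le_unarySize τ
  have hS' : (1 : ℝ) ≤ S := by exact_mod_cast hS
  have hSe' : (S : ℝ) ≤ e := by exact_mod_cast hSe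
  rw [dbfMM, Int.cast_sum]
  obtain rfl | ⟨k, rfl⟩ : m = 1 ∨ ∃ k, m = k + 2 := by
    rcases m with _ | _ | k
    · omega
    · exact Or.inl rfl
    · exact Or.inr ⟨k, rfl⟩
  · calc ∑ i with 1 ≤ (τ i).L + 1, ((τ i).dbfMM S e 1 : ℝ)
        = ∑ i, ((τ i).dbfMM S e 1 : ℝ) := by simp
      _ ≤ ∑ i, ((e : ℝ) * (((τ i).C 1 : ℝ) / (τ i).T) + 3 * (τ i).T) :=
          Finset.sum_le_sum fun i _ => MCTask.dbfMM_one_le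
      _ = e * utilization τ 1 + 3 * ∑ i, ((τ i).T : ℝ) := by
          rw [Finset.sum_add_distrib, ← Finset.mul_sum, ← Finset.mul_sum, utilization,
            Finset.filter_true_of_mem (fun i _ => (τ i).one_le_L)]
      _ ≤ _ := by nlinarith [hc 1 le_rfl hmM]
  · have h1 := hc (k + 1) (by omega) (by omega)
    have h2 := hc (k + 2) (by omega) hmM
    calc ∑ i with k + 2 ≤ (τ i).L + 1, ((τ i).dbfMM S e (k + 2) : ℝ)
        ≤ ∑ i with k + 2 ≤ (τ i).L + 1, ((S : ℝ) * (((τ i).C (k + 1) : ℝ) / (τ i).T) +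
            (e - S) * (if k + 2 ≤ (τ i).L then ((τ i).C (k + 2) : ℝ) / (τ i).T else 0)
            + 3 * (τ i).T) :=
          Finset.sum_le_sum fun i hi =>
            MCTask.dbfMM_le (by have := (Finset.mem_filter.1 hi).2; omega) hS hSe
      _ = S * (∑ i with k + 2 ≤ (τ i).L + 1, ((τ i).C (k + 1) : ℝ) / (τ i).T) +
          (e - S) * (∑ i with k + 2 ≤ (τ i).L + 1,
            if k + 2 ≤ (τ i).L then ((τ i).C (k + 2) : ℝ) / (τ i).T else 0) +
          3 * ∑ i with k + 2 ≤ (τ i).L + 1, ((τ i).T : ℝ) := by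
          rw [Finset.sum_add_distrib, Finset.sum_add_distrib, ← Finset.mul_sum, ← Finset.mul_sum,
            ← Finset.mul_sum]
      _ = S * utilization τ (k + 1) + (e - S) * utilization τ (k + 2) +
          3 * ∑ i with k + 2 ≤ (τ i).L + 1, ((τ i).T : ℝ) := by
          congr 3
          · rw [utilization]
            congr 1
            ext i
            simp only [Finset.mem_filter, Finset.mem_univ, true_and]
            omega
          · rw [utilization, ← Finset.sum_filter, Finset.filter_filter]
            congr 1
            ext i
            simp only [Finset.mem_filter, Finset.mem_univ, true_and]
            omega
      _ ≤ S * c + (e - S) * c + 3 * unarySize τ := by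
          have h3 : ∑ i with k + 2 ≤ (τ i).L + 1, ((τ i).T : ℝ) ≤ ∑ i, ((τ i).T : ℝ) :=
            Finset.sum_le_sum_of_subset_of_nonneg (Finset.filter_subset _ _)
              (fun _ _ _ => by positivity)
          have h4 : (S : ℝ) * utilization τ (k + 1) ≤ S * c :=
            mul_le_mul_of_nonneg_left h1 (by linarith)
          have h5 : ((e : ℝ) - S) * utilization τ (k + 2) ≤ (e - S) * c :=
            mul_le_mul_of_nonneg_left h2 (by linarith)
          linarith
      _ = _ := by ring

/-! ### The demand test -/

/-- The interval length `e` violates the demand test for some mode and some mode-switch time. -/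
def Overloaded (τ : Fin n → MCTask) (e : ℕ) : Prop :=
  ∃ m S : ℕ, 1 ≤ m ∧ m ≤ maxLevel τ ∧ 1 ≤ S ∧ S ≤ e ∧ (e : ℤ) < dbfMM τ S e m

/-- The supremum of all interval lengths that violate the demand test. -/
noncomputable def testBound (τ : Fin n → MCTask) : ℕ∞ := ⨆ (e : ℕ) (_ : Overloaded τ e), (e : ℕ∞)

theorem le_testBound {e : ℕ} (h : Overloaded τ e) : (e : ℕ∞) ≤ testBound τ :=
  le_iSup₂ (f := fun (e : ℕ) (_ : Overloaded τ e) => (e : ℕ∞)) e h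

/-- If every mode has utilization at most `c < 1`, the demand bound is at most `c e + O(|τ|)`, and so
it exceeds `e` only if `e` is linear in the unary size. -/
theorem testBound_le {c : ℝ} (hc1 : c < 1)
    (hc : ∀ m, 1 ≤ m → m ≤ maxLevel τ → utilization τ m ≤ c) :
    testBound τ ≤ ((⌈3 / (1 - c)⌉₊ * unarySize τ : ℕ) : ℕ∞) := by
  refine iSup₂_le fun e ⟨m, S, hm, hmM, hS, hSe, hlt⟩ => ?_
  have h1 := dbfMM_le hc hm hmM (S := S) (e := e) (by exact_mod_cast hS) (by exact_mod_cast hSe)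
  have h2 : (e : ℝ) < (dbfMM τ S e m : ℝ) := by exact_mod_cast hlt
  have h3 : (e : ℝ) * (1 - c) ≤ 3 * unarySize τ := by
    push_cast at h1
    linarith
  have h4 : (e : ℝ) ≤ ⌈3 / (1 - c)⌉₊ * unarySize τ := by
    have h0 : 0 < 1 - c := by linarith
    calc (e : ℝ) ≤ 3 * unarySize τ / (1 - c) := by rwa [le_div_iff₀ h0]
      _ = 3 / (1 - c) * unarySize τ := by ring
      _ ≤ _ := mul_le_mul_of_nonneg_right (Nat.le_ceil _) (by positivity)
  exact_mod_cast h4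

/-- The demand test, for all interval lengths and in integer arithmetic. -/
def PassesTest (τ : Fin n → MCTask) : Prop :=
  ∀ m : ℕ, 1 ≤ m → m ≤ maxLevel τ → ∀ S e : ℤ, 1 ≤ S → S ≤ e → dbfMM τ S e m ≤ e

theorem passesTest_of_le_testBound (h : ∀ m : ℕ, 1 ≤ m → m ≤ maxLevel τ → ∀ e : ℕ, 1 ≤ e →
    (e : ℕ∞) ≤ testBound τ → ∀ S : ℕ, 1 ≤ S → S ≤ e → dbfMM τ S e m ≤ e) : PassesTest τ := by
  intro m hm hmM S e hS hSe
  lift S to ℕ using by omega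
  lift e to ℕ using by omega
  by_contra hlt
  push Not at hlt
  have hS' : 1 ≤ S := by exact_mod_cast hS
  have hSe' : S ≤ e := by exact_mod_cast hSe
  exact absurd (h m hm hmM e (by omega)
    (le_testBound ⟨m, S, hm, hmM, hS', hSe', hlt⟩) S hS' hSe') (not_le.2 hlt)

end MCTaskSet

/-! ### Demand of a job set -/

namespace MCTask

/-- The weight `w` of a job released at `r` is negligible, or it respects the demand bounds of the
carry-over jobs, of the jobs released before the mode switch at `S`, or of those released later,
for an interval `[0, e)` at whose start mode `k + 1` is entered. -/
def WeightBounded (t : MCTask) (k : ℕ) (S e r : ℤ) (w : ℝ) : Prop :=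
  w ≤ 0 ∨ (k + 1 ≤ t.L ∧ -(t.T : ℤ) < r ∧
    (t.L = k + 1 → (r ≤ 0 → w ≤ t.demandA (k + 2) S e r) ∧
      (0 < r → r ≤ S ∧ w ≤ t.demandB (k + 2) S e r)) ∧
    (k + 2 ≤ t.L → (r ≤ 0 → w ≤ t.demandC (k + 2) S e r) ∧
      (0 < r → r ≤ S → w ≤ t.demandD (k + 2) S e r) ∧
      (0 < r → r + t.T ≤ S → w ≤ t.C (k + 1)) ∧
      (S < r → r + t.V (k + 2) ≤ e ∧ w ≤ t.C (k + 2))))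

/-- Bounds on the execution of a job yield the bounds on its weight. Here `X` stands for minus the
execution received before time `0`. -/
theorem weightBounded_of {t : MCTask} {k : ℕ} (hk : k + 1 ≤ t.L) {S e r : ℤ} {w X : ℝ} (hS : 1 ≤ S)
    (hre : r + t.V (k + 1) ≤ e)
    (hcarry : r ≤ 0 → 0 ≤ r + t.V k ∧ -(t.T : ℤ) < r ∧
      X ≤ ((min (r + t.V k) (t.C k) - t.C k : ℤ) : ℝ))
    (hX : 0 < r → X ≤ 0)
    (hearly : k + 2 ≤ t.L → r + t.V (k + 1) < S → w ≤ t.C (k + 1) + X)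
    (hhigh : k + 2 ≤ t.L → w ≤ t.C (k + 2) + X)
    (hlow : k + 2 ≤ t.L → r + t.V (k + 2) ≤ e ∨ w ≤ t.C (k + 1) + X ∧ w ≤ max 0 ((S - max r 0 : ℤ) : ℝ))
    (hlow' : t.L = k + 1 → w ≤ t.C (k + 1) + X ∧ w ≤ max 0 ((S - max r 0 : ℤ) : ℝ))
    (hmid : k + 2 ≤ t.L → 0 < r → r + t.T ≤ S → w ≤ t.C (k + 1)) : t.WeightBounded k S e r w := by
  rcases le_or_gt w 0 with hw | hw
  · exact Or.inl hw
  have hpos : ∀ z : ℤ, w ≤ max 0 (z : ℝ) → w ≤ z := fun z h => by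
    rcases le_max_iff.1 h with h | h
    · linarith
    · exact h
  have hpos' : ∀ z : ℤ, w ≤ max 0 (z : ℝ) → 0 < z := fun z h => by
    have : (0 : ℝ) < z := hw.trans_le (hpos z h)
    exact_mod_cast this
  refine Or.inr ⟨hk, ?_, fun hL => ⟨fun hr => ?_, fun hr => ⟨?_, ?_⟩⟩, fun hL =>
    ⟨fun hr => ?_, fun hr hrS => ?_, hmid hL, fun hrS => ⟨?_, ?_⟩⟩⟩
  · rcases le_or_gt r 0 with h | h
    · exact (hcarry h).2.1
    · have := t.T_pos
      omega
  · obtain ⟨h1, h2⟩ := hlow' hL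
    obtain ⟨h3, -, h4⟩ := hcarry hr
    have h5 := hpos _ h2
    rw [demandA_eq, if_pos ⟨by omega, hre⟩]
    rw [max_eq_right hr, sub_zero] at h5
    rw [Int.cast_min, le_min_iff]
    refine ⟨?_, h5⟩
    push_cast at h4 ⊢
    linarith
  · have := hpos' _ (hlow' hL).2
    omega
  · obtain ⟨h1, h2⟩ := hlow' hL
    have h5 := hpos _ h2
    rw [max_eq_left hr.le] at h5
    rw [demandB_eq, if_pos hre, Int.cast_min, le_min_iff]
    refine ⟨?_, h5⟩
    have := hX hr
    push_cast
    linarith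
  · obtain ⟨h3, -, h4⟩ := hcarry hr
    have h6 := hhigh hL
    rw [demandC_eq, if_neg (by omega)]
    split_ifs with h7 h8
    · have := hearly hL h7
      push_cast at h4 ⊢
      linarith
    · push_cast at h4 ⊢
      linarith
    · obtain ⟨h1, h2⟩ := (hlow hL).resolve_left h8
      have h5 := hpos _ h2
      rw [max_eq_right hr, sub_zero] at h5
      rw [Int.cast_min, le_min_iff]
      refine ⟨h5, ?_⟩
      push_cast at h4 ⊢
      linarith
  · have hX0 := hX hr
    have h6 := hhigh hL
    rw [demandD_eq, if_neg (by omega)]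
    split_ifs with h7 h8
    · have := hearly hL h7
      push_cast
      linarith
    · push_cast
      linarith
    · obtain ⟨h1, h2⟩ := (hlow hL).resolve_left h8
      have h5 := hpos _ h2
      rw [max_eq_left hr.le] at h5
      rw [Int.cast_min, le_min_iff]
      refine ⟨?_, h5⟩
      push_cast
      linarith
  · rcases hlow hL with h | ⟨-, h⟩
    · exact h
    · have := hpos' _ h
      omega
  · have := hX (by omega)
    have := hhigh hL
    linarith

end MCTask

namespace MCTaskSet

variable {n : ℕ} {τ : Fin n → MCTask}

theorem sum_jobs_eq (𝒥 : Finset (MCJob n)) (o : ℤ) (w : MCJob n → ℝ) : ∑ J ∈ 𝒥, w J =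
    ∑ i, ∑ r ∈ (𝒥.filter (·.1 = i)).image (fun J => (J.2 : ℤ) - o), w (i, (r + o).toNat) := by
  classical
  rw [← Finset.sum_fiberwise 𝒥 (·.1) w]
  refine Finset.sum_congr rfl fun i _ => ?_
  rw [Finset.sum_image]
  · refine Finset.sum_congr rfl fun J hJ => ?_
    have : J.1 = i := (Finset.mem_filter.1 hJ).2
    subst this
    simp
  · rintro ⟨i1, r1⟩ h1 ⟨i2, r2⟩ h2 h
    have e1 : i1 = i := (Finset.mem_filter.1 h1).2
    have e2 : i2 = i := (Finset.mem_filter.1 h2).2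
    simp only [sub_left_inj, Nat.cast_inj] at h
    rw [e1, e2, h]

/-- A separated job set whose weights respect the demand bounds weighs no more than the interval is
long, if the task set passes the test. -/
theorem sum_weight_le (hτ : PassesTest τ) {k : ℕ} (hk : k + 2 ≤ maxLevel τ) {o S e : ℤ} (hS : 1 ≤ S)
    (hSe : S ≤ e) {𝒥 : Finset (MCJob n)} {w : MCJob n → ℝ}
    (hsep : ∀ J ∈ 𝒥, ∀ J' ∈ 𝒥, J.1 = J'.1 → J.2 < J'.2 → J.2 + (τ J.1).T ≤ J'.2)
    (hw : ∀ J ∈ 𝒥, (τ J.1).WeightBounded k S e (J.2 - o) (w J)) : ∑ J ∈ 𝒥, w J ≤ e := by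
  classical
  set 𝒬 := 𝒥.filter (0 < w ·) with h𝒬
  have h1 : ∑ J ∈ 𝒥, w J ≤ ∑ J ∈ 𝒬, w J := by
    rw [← Finset.sum_filter_add_sum_filter_not 𝒥 (0 < w ·)]
    have : ∑ J ∈ 𝒥 with ¬ 0 < w J, w J ≤ 0 :=
      Finset.sum_nonpos fun J hJ => not_lt.1 (Finset.mem_filter.1 hJ).2
    linarith
  refine h1.trans ?_
  rw [sum_jobs_eq 𝒬 o w]
  have hmem : ∀ i, ∀ r ∈ (𝒬.filter (·.1 = i)).image (fun J => (J.2 : ℤ) - o),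
      ∃ J ∈ 𝒥, J.1 = i ∧ r = J.2 - o ∧ (i, (r + o).toNat) = J ∧ 0 < w J := by
    intro i r hr
    obtain ⟨J, hJ, rfl⟩ := Finset.mem_image.1 hr
    obtain ⟨hJ1, rfl⟩ := Finset.mem_filter.1 hJ
    obtain ⟨hJ2, hJ3⟩ := Finset.mem_filter.1 hJ1
    exact ⟨J, hJ2, rfl, rfl, by simp, hJ3⟩
  have htask : ∀ i, ∑ r ∈ (𝒬.filter (·.1 = i)).image (fun J => (J.2 : ℤ) - o),
      w (i, (r + o).toNat) ≤ if k + 2 ≤ (τ i).L + 1 then ((τ i).dbfMM S e (k + 2) : ℝ) else 0 := by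
    intro i
    set R := (𝒬.filter (·.1 = i)).image (fun J => (J.2 : ℤ) - o) with hR
    have hsepR : ∀ r ∈ R, ∀ r' ∈ R, r < r' → r + (τ i).T ≤ r' := by
      intro r hr r' hr' hlt
      obtain ⟨J, hJ, rfl, rfl, -⟩ := hmem i r hr
      obtain ⟨J', hJ', he, rfl, -⟩ := hmem J.1 r' hr'
      have := hsep J hJ J' hJ' he.symm (by omega)
      omega
    have hwB : ∀ r ∈ R, (τ i).WeightBounded k S e r (w (i, (r + o).toNat)) ∧
        0 < w (i, (r + o).toNat) := fun r hr => by
      obtain ⟨J, hJ, rfl, rfl, he, hpos⟩ := hmem i r hr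
      rw [he]
      exact ⟨hw J hJ, hpos⟩
    have hwR := fun r hr => (hwB r hr).1.resolve_left (not_le.2 (hwB r hr).2)
    rcases Nat.lt_trichotomy ((τ i).L) (k + 1) with hL | hL | hL
    · rw [if_neg (by omega), Finset.sum_eq_zero]
      intro r hr
      have := (hwR r hr).1
      omega
    · rw [if_pos (by omega)]
      refine MCTask.sum_le_dbfMM_low hL hS hSe hsepR (fun r hr => (hwR r hr).2.1)
        (fun r hr => (((hwR r hr).2.2.1 hL).1)) (fun r hr h0 _ => (((hwR r hr).2.2.1 hL).2 h0).2)
        (fun r hr h0 => ?_)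
      have := (((hwR r hr).2.2.1 hL).2 (by omega)).1
      omega
    · rw [if_pos (by omega)]
      refine MCTask.sum_le_dbfMM_high hL hS hSe hsepR (fun r hr => (hwR r hr).2.1)
        (fun r hr => (((hwR r hr).2.2.2 hL).1)) (fun r hr => (((hwR r hr).2.2.2 hL).2.1))
        (fun r hr => (((hwR r hr).2.2.2 hL).2.2.1))
        (fun r hr h0 _ => (((hwR r hr).2.2.2 hL).2.2.2 h0).2) (fun r hr h0 h1 => ?_)
      have := (((hwR r hr).2.2.2 hL).2.2.2 h0).1
      omega
  calc _ ≤ ∑ i, if k + 2 ≤ (τ i).L + 1 then ((τ i).dbfMM S e (k + 2) : ℝ) else 0 :=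
        Finset.sum_le_sum fun i _ => htask i
    _ = (dbfMM τ S e (k + 2) : ℝ) := by
        rw [dbfMM, Int.cast_sum, Finset.sum_filter]
    _ ≤ e := by exact_mod_cast hτ (k + 2) (by omega) hk S e hS hSe

/-- The analogue of `sum_weight_le` for mode `1`. -/
theorem sum_weight_le_one (hτ : PassesTest τ) (hM : 1 ≤ maxLevel τ) {o e : ℤ} (he : 1 ≤ e)
    {𝒥 : Finset (MCJob n)} {w : MCJob n → ℝ}
    (hsep : ∀ J ∈ 𝒥, ∀ J' ∈ 𝒥, J.1 = J'.1 → J.2 < J'.2 → J.2 + (τ J.1).T ≤ J'.2)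
    (hw : ∀ J ∈ 𝒥, w J ≤ 0 ∨ (o ≤ J.2 ∧ (J.2 - o) + (τ J.1).V 1 ≤ e ∧ w J ≤ (τ J.1).C 1)) :
    ∑ J ∈ 𝒥, w J ≤ e := by
  classical
  set 𝒬 := 𝒥.filter (0 < w ·) with h𝒬
  have h1 : ∑ J ∈ 𝒥, w J ≤ ∑ J ∈ 𝒬, w J := by
    rw [← Finset.sum_filter_add_sum_filter_not 𝒥 (0 < w ·)]
    have : ∑ J ∈ 𝒥 with ¬ 0 < w J, w J ≤ 0 :=
      Finset.sum_nonpos fun J hJ => not_lt.1 (Finset.mem_filter.1 hJ).2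
    linarith
  refine h1.trans ?_
  rw [sum_jobs_eq 𝒬 o w]
  have hmem : ∀ i, ∀ r ∈ (𝒬.filter (·.1 = i)).image (fun J => (J.2 : ℤ) - o),
      ∃ J ∈ 𝒥, J.1 = i ∧ r = J.2 - o ∧ (i, (r + o).toNat) = J ∧ 0 < w J := by
    intro i r hr
    obtain ⟨J, hJ, rfl⟩ := Finset.mem_image.1 hr
    obtain ⟨hJ1, rfl⟩ := Finset.mem_filter.1 hJ
    obtain ⟨hJ2, hJ3⟩ := Finset.mem_filter.1 hJ1
    exact ⟨J, hJ2, rfl, rfl, by simp, hJ3⟩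
  have htask : ∀ i, ∑ r ∈ (𝒬.filter (·.1 = i)).image (fun J => (J.2 : ℤ) - o),
      w (i, (r + o).toNat) ≤ ((τ i).dbfMM 1 e 1 : ℝ) := by
    intro i
    have hwR : ∀ r ∈ (𝒬.filter (·.1 = i)).image (fun J => (J.2 : ℤ) - o),
        0 ≤ r ∧ r + (τ i).V 1 ≤ e ∧ w (i, (r + o).toNat) ≤ (τ i).C 1 := fun r hr => by
      obtain ⟨J, hJ, rfl, rfl, he, hpos⟩ := hmem i r hr
      obtain ⟨h1, h2, h3⟩ := (hw J hJ).resolve_left (not_le.2 hpos)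
      rw [he]
      exact ⟨by omega, h2, h3⟩
    refine MCTask.sum_le_dbfMM_one (by omega) ?_ (fun r hr => (hwR r hr).1)
      (fun r hr _ => (hwR r hr).2.2) (fun r hr h => ?_)
    · intro r hr r' hr' hlt
      obtain ⟨J, hJ, rfl, rfl, -⟩ := hmem i r hr
      obtain ⟨J', hJ', he, rfl, -⟩ := hmem J.1 r' hr'
      have := hsep J hJ J' hJ' he.symm (by omega)
      omega
    · have := (hwR r hr).2.1
      omega
  calc _ ≤ ∑ i, ((τ i).dbfMM 1 e 1 : ℝ) := Finset.sum_le_sum fun i _ => htask i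
    _ = (dbfMM τ 1 e 1 : ℝ) := by
        rw [dbfMM, Int.cast_sum, Finset.filter_true_of_mem (fun i _ => by omega)]
    _ ≤ e := by exact_mod_cast hτ 1 le_rfl hM 1 e le_rfl he

/-- Under the test, no virtual deadline is shorter than the budget: a single job must fit. -/
theorem C_le_V (hτ : PassesTest τ) (i : Fin n) (m : ℕ) (hm : m ≤ (τ i).L) :
    (τ i).C m ≤ (τ i).V m := by
  induction m using Nat.strong_induction_on with
  | _ m ih =>
    have hM := le_maxLevel τ i
    rcases m with _ | _ | k
    · simp [(τ i).C_zero]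
    · have hV := (τ i).V_pos le_rfl hm
      have := sum_weight_le_one hτ (by omega) (o := 0) (e := (τ i).V 1) (by exact_mod_cast hV)
        (𝒥 := {(i, 0)}) (w := fun _ => ((τ i).C 1 : ℝ)) (by simp) (by simp)
      simpa using this
    · have hV := (τ i).V_pos (by omega) hm
      have hVV : (τ i).V (k + 1) ≤ (τ i).V (k + 2) := (τ i).V_le_succ hm
      have hV1 := (τ i).V_pos (m := k + 1) (by omega) (by omega)
      have hCV := ih k (by omega) (by omega)
      have hT := (τ i).T_pos
      have := sum_weight_le hτ (k := k) (by omega) (o := 0) (S := 1) (e := (τ i).V (k + 2)) le_rfl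
        (by exact_mod_cast hV) (𝒥 := {(i, 0)}) (w := fun _ => ((τ i).C (k + 2) : ℝ)) (by simp) (by
          intro J hJ
          rw [Finset.mem_singleton] at hJ
          subst hJ
          change (τ i).WeightBounded k 1 _ (((0 : ℕ) : ℤ) - 0) _
          refine MCTask.weightBounded_of (X := 0) (by omega) le_rfl ?_ ?_ ?_ ?_ ?_ ?_ ?_ ?_
          · simp only [Nat.cast_zero]
            omega
          · intro _
            refine ⟨by positivity, by simpa using hT, ?_⟩
            have : (0 : ℤ) ≤ min (((0 : ℕ) : ℤ) - 0 + (τ i).V k) ((τ i).C k) - (τ i).C k := by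
              omega
            exact_mod_cast this
          · simp
          · intro _ h
            simp only [Nat.cast_zero] at h
            omega
          · simp
          · simp
          · intro h
            omega
          · simp)
      simpa using this

end MCTaskSet

/-! ### Execution over time -/

namespace MCTrace

variable {n : ℕ} {x : MCTrace n} {J : MCJob n} {a b c : ℝ}

/-- Amount of execution that job `J` receives in `[a, b)`. -/
noncomputable def ran (x : MCTrace n) (J : MCJob n) (a b : ℝ) : ℝ :=
  volume.real {s : ℝ | a ≤ s ∧ s < b ∧ x.sched s = some J}

theorem ran_nonneg : 0 ≤ x.ran J a b := measureReal_nonneg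

theorem executed_nonneg : 0 ≤ x.executed J a := measureReal_nonneg

theorem ran_le (h : a ≤ b) : x.ran J a b ≤ b - a := by
  rw [← Real.volume_real_Ico_of_le h]
  exact measureReal_mono (fun s hs => ⟨hs.1, hs.2.1⟩) measure_Ico_lt_top.ne

theorem ran_eq_zero_of_ne {p : ℝ} (h : ∀ u, a < u → u < b → u ≠ p → x.sched u ≠ some J) :
    x.ran J a b = 0 := by
  have hsub : {s : ℝ | a ≤ s ∧ s < b ∧ x.sched s = some J} ⊆ {a, p} := by
    rintro s ⟨h1, h2, h3⟩
    by_contra hs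
    simp only [Set.mem_insert_iff, Set.mem_singleton_iff, not_or] at hs
    exact h s (lt_of_le_of_ne h1 (Ne.symm hs.1)) h2 hs.2 h3
  have h0 : volume ({a, p} : Set ℝ) = 0 := (Set.toFinite _).measure_zero _
  rw [ran, Measure.real, measure_mono_null hsub h0, ENNReal.toReal_zero]

theorem ran_eq_zero (h : ∀ u, a < u → u < b → x.sched u ≠ some J) : x.ran J a b = 0 :=
  ran_eq_zero_of_ne (p := a) fun u h1 h2 _ => h u h1 h2

theorem ran_add (hm : MeasurableSet {s : ℝ | x.sched s = some J}) (hab : a ≤ b) (hbc : b ≤ c) :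
    x.ran J a c = x.ran J a b + x.ran J b c := by
  have hset : {s : ℝ | a ≤ s ∧ s < c ∧ x.sched s = some J} =
      {s : ℝ | a ≤ s ∧ s < b ∧ x.sched s = some J} ∪
      {s : ℝ | b ≤ s ∧ s < c ∧ x.sched s = some J} := by
    ext s
    simp only [Set.mem_ofPred_eq, Set.mem_union]
    constructor
    · rintro ⟨h1, h2, h3⟩
      rcases lt_or_ge s b with h | h
      · exact Or.inl ⟨h1, h, h3⟩
      · exact Or.inr ⟨h, h2, h3⟩
    · rintro (⟨h1, h2, h3⟩ | ⟨h1, h2, h3⟩)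
      · exact ⟨h1, h2.trans_le hbc, h3⟩
      · exact ⟨hab.trans h1, h2, h3⟩
  have hmeas : MeasurableSet {s : ℝ | b ≤ s ∧ s < c ∧ x.sched s = some J} := by
    have : {s : ℝ | b ≤ s ∧ s < c ∧ x.sched s = some J} =
        Set.Ico b c ∩ {s : ℝ | x.sched s = some J} := by
      ext s
      simp [and_assoc]
    rw [this]
    exact measurableSet_Ico.inter hm
  have hdisj : Disjoint {s : ℝ | a ≤ s ∧ s < b ∧ x.sched s = some J}
      {s : ℝ | b ≤ s ∧ s < c ∧ x.sched s = some J} := by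
    rw [Set.disjoint_left]
    rintro s ⟨-, h, -⟩ ⟨h', -⟩
    exact absurd h (not_lt.2 h')
  rw [ran, hset, measureReal_union hdisj hmeas (ne_top_of_le_ne_top measure_Ico_lt_top.ne
      (measure_mono (fun s hs => ⟨hs.1, hs.2.1⟩ : _ ⊆ Set.Ico a b)))
    (ne_top_of_le_ne_top measure_Ico_lt_top.ne
      (measure_mono (fun s hs => ⟨hs.1, hs.2.1⟩ : _ ⊆ Set.Ico b c)))]
  rfl

theorem executed_add_ran (hm : MeasurableSet {s : ℝ | x.sched s = some J}) (ha : 0 ≤ a)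
    (hab : a ≤ b) : x.executed J a + x.ran J a b = x.executed J b :=
  (ran_add hm ha hab).symm

theorem executed_mono : Monotone (x.executed J) := by
  intro a b hab
  exact measureReal_mono (fun s hs => ⟨hs.1, hs.2.1.trans_le hab, hs.2.2⟩)
    (ne_top_of_le_ne_top measure_Ico_lt_top.ne
      (measure_mono (fun s hs => ⟨hs.1, hs.2.1⟩ : _ ⊆ Set.Ico 0 b)))

theorem continuous_executed : Continuous (x.executed J) := by
  refine (LipschitzWith.of_le_add fun b a => ?_).continuous
  rcases le_total b a with h | h
  · exact (executed_mono h).trans (by linarith [dist_nonneg (x := b) (y := a)])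
  · rw [Real.dist_eq, abs_of_nonneg (sub_nonneg.2 h)]
    have hsub : {s : ℝ | 0 ≤ s ∧ s < b ∧ x.sched s = some J} ⊆
        {s : ℝ | 0 ≤ s ∧ s < a ∧ x.sched s = some J} ∪ Set.Ico a b := by
      rintro s ⟨h1, h2, h3⟩
      rcases lt_or_ge s a with h | h
      · exact Or.inl ⟨h1, h, h3⟩
      · exact Or.inr ⟨h, h2⟩
    have hfin : volume {s : ℝ | 0 ≤ s ∧ s < a ∧ x.sched s = some J} ≠ ⊤ :=
      ne_top_of_le_ne_top measure_Ico_lt_top.ne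
        (measure_mono (fun s hs => ⟨hs.1, hs.2.1⟩ : _ ⊆ Set.Ico 0 a))
    calc x.executed J b ≤ volume.real ({s : ℝ | 0 ≤ s ∧ s < a ∧ x.sched s = some J} ∪ Set.Ico a b) :=
          measureReal_mono hsub
            ((measure_union_lt_top (lt_top_iff_ne_top.2 hfin) measure_Ico_lt_top).ne)
      _ ≤ volume.real {s : ℝ | 0 ≤ s ∧ s < a ∧ x.sched s = some J} + volume.real (Set.Ico a b) :=
          measureReal_union_le _ _
      _ = x.executed J a + (b - a) := by rw [Real.volume_real_Ico_of_le h]; rfl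

theorem executed_of_nonpos (h : a ≤ 0) : x.executed J a = 0 := by
  have : {s : ℝ | 0 ≤ s ∧ s < a ∧ x.sched s = some J} = ∅ := by
    ext s
    simp only [Set.mem_ofPred_eq, Set.mem_empty_iff_false, iff_false]
    rintro ⟨h1, h2, -⟩
    linarith
  rw [executed, this]
  simp

/-- If job `J` does not run any more once it has executed for `c`, it never executes longer. -/
theorem executed_le_of_stops (hm : MeasurableSet {s : ℝ | x.sched s = some J}) (hc : 0 ≤ c)
    (h : ∀ s, 0 ≤ s → s < b → c ≤ x.executed J s → ∀ u, s < u → u < b → x.sched u ≠ some J) :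
    x.executed J b ≤ c := by
  by_contra hlt
  push Not at hlt
  have hb : 0 < b := by
    by_contra hb
    rw [executed_of_nonpos (not_lt.1 hb)] at hlt
    linarith
  obtain ⟨s, ⟨hs0, hsb⟩, hs⟩ := intermediate_value_Icc hb.le continuous_executed.continuousOn
    (show c ∈ Set.Icc (x.executed J 0) (x.executed J b) from
      ⟨by rw [executed_of_nonpos le_rfl]; exact hc, hlt.le⟩)
  have hsb' : s < b := by
    rcases hsb.lt_or_eq with h | h
    · exact h
    · rw [h] at hs
      linarith
  have := executed_add_ran hm hs0 hsb
  rw [ran_eq_zero (h s hs0 hsb' hs.ge)] at this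
  linarith

/-- While the processor is busy with jobs from `𝒥`, except possibly at the single instant `p`, the
execution times of these jobs add up to at least the elapsed time. -/
theorem sub_le_sum_ran (hab : a ≤ b) {p : ℝ} {𝒥 : Finset (MCJob n)}
    (h : ∀ u, a < u → u < b → u ≠ p → ∃ J ∈ 𝒥, x.sched u = some J) :
    b - a ≤ ∑ J ∈ 𝒥, x.ran J a b := by
  have hsub : Set.Ioo a b ⊆ {p} ∪ ⋃ J ∈ 𝒥, {s : ℝ | a ≤ s ∧ s < b ∧ x.sched s = some J} := by
    rintro s ⟨h1, h2⟩
    by_cases hp : s = p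
    · exact Or.inl hp
    · obtain ⟨J, hJ, hs⟩ := h s h1 h2 hp
      exact Or.inr (Set.mem_biUnion hJ ⟨h1.le, h2, hs⟩)
  have hfin : volume (⋃ J ∈ 𝒥, {s : ℝ | a ≤ s ∧ s < b ∧ x.sched s = some J}) ≠ ⊤ :=
    ne_top_of_le_ne_top measure_Ico_lt_top.ne
      (measure_mono (Set.iUnion₂_subset fun J _ s hs => ⟨hs.1, hs.2.1⟩ : _ ⊆ Set.Ico a b))
  calc b - a = volume.real (Set.Ioo a b) := (Real.volume_real_Ioo_of_le hab).symm
    _ ≤ volume.real ({p} ∪ ⋃ J ∈ 𝒥, {s : ℝ | a ≤ s ∧ s < b ∧ x.sched s = some J}) :=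
        measureReal_mono hsub (measure_union_lt_top (by simp) (lt_top_iff_ne_top.2 hfin)).ne
    _ ≤ volume.real {p} + volume.real (⋃ J ∈ 𝒥, {s : ℝ | a ≤ s ∧ s < b ∧ x.sched s = some J}) :=
        measureReal_union_le _ _
    _ ≤ 0 + ∑ J ∈ 𝒥, x.ran J a b :=
        add_le_add (by simp [Measure.real]) (measureReal_biUnion_finset_le _ _)
    _ = _ := zero_add _

variable {τ : Fin n → MCTask} {t s u : ℝ}

theorem Finished.mono (h : x.Finished J s) (hst : s ≤ t) : x.Finished J t :=
  le_trans h (executed_mono hst)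

theorem Pending.of_le (h : Pending τ x J t) (hs : (J.2 : ℝ) ≤ s) (hst : s ≤ t) : Pending τ x J s :=
  ⟨h.1, hs, fun hf => h.2.2.1 (hf.mono hst), fun v hv hvs => h.2.2.2 v hv (hvs.trans hst)⟩

namespace IsEDFRun

theorem pending_of_sched (hx : x.IsEDFRun τ) (hu : 0 ≤ u) (h : x.sched u = some J) :
    Pending τ x J u :=
  (hx.edf u hu J h).1

theorem ran_eq_zero_of_finished (hx : x.IsEDFRun τ) (ha : 0 ≤ a) (h : x.Finished J a) :
    x.ran J a b = 0 :=
  ran_eq_zero fun _ hau _ hs =>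
    (hx.pending_of_sched (ha.trans hau.le) hs).2.2.1 (h.mono hau.le)

theorem executed_eq_zero (hx : x.IsEDFRun τ) (h : a ≤ J.2) : x.executed J a = 0 :=
  ran_eq_zero fun _ h0 hua hs =>
    absurd (hx.pending_of_sched h0.le hs).2.1 (not_le.2 (hua.trans_le h))

theorem executed_eq_of_finished (hx : x.IsEDFRun τ) (ha : 0 ≤ a) (hab : a ≤ b)
    (h : x.Finished J a) :
    x.executed J b = x.executed J a := by
  rw [← executed_add_ran (hx.measurable J) ha hab, hx.ran_eq_zero_of_finished ha h, add_zero]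

end IsEDFRun

end MCTrace

/-! ### Busy episodes -/

namespace MCTrace

variable {n : ℕ} {τ : Fin n → MCTask} {x : MCTrace n} {J : MCJob n} {t₀ : ℕ} {h t u : ℝ} {m : ℕ}

/-- The run is continuously busy on `[t₀, h)` with jobs released at `t₀` or later, and the mode is
not reset in between. -/
structure Episode (τ : Fin n → MCTask) (x : MCTrace n) (t₀ : ℕ) (h : ℝ) : Prop where
  run : x.IsEDFRun τ
  lt : (t₀ : ℝ) < h
  fresh : ∀ J : MCJob n, J.2 < t₀ → ¬ Pending τ x J t₀
  busy : ∀ u : ℝ, t₀ ≤ u → u < h → ∃ J, x.sched u = some J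
  mode_mono : ∀ u v : ℝ, t₀ ≤ u → u ≤ v → v < h → x.mode u ≤ x.mode v

/-- The time at which mode `m` is entered (or exceeded) during an episode; it is the end `h` of the
episode if the mode stays below `m`. -/
noncomputable def entry (x : MCTrace n) (t₀ : ℕ) (h : ℝ) (m : ℕ) : ℝ :=
  sInf (insert h {u : ℝ | t₀ ≤ u ∧ u < h ∧ m ≤ x.mode u})

/-- Job `J` was released during the episode that started at `t₀`, and has not signalled completion
by time `t`. -/
def Unfinished (x : MCTrace n) (t₀ : ℕ) (J : MCJob n) (t : ℝ) : Prop :=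
  J.2 ∈ x.releases J.1 ∧ t₀ ≤ J.2 ∧ (J.2 : ℝ) ≤ t ∧ ¬ x.Finished J t

theorem Unfinished.of_le (hJ : x.Unfinished t₀ J t) (hu : (J.2 : ℝ) ≤ u) (hut : u ≤ t) :
    x.Unfinished t₀ J u :=
  ⟨hJ.1, hJ.2.1, hu, fun hf => hJ.2.2.2 (hf.mono hut)⟩

theorem Unfinished.start_le (hJ : x.Unfinished t₀ J t) : (t₀ : ℝ) ≤ J.2 := by
  exact_mod_cast hJ.2.1

namespace Episode

theorem bddBelow (E : Episode τ x t₀ h) (m : ℕ) :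
    BddBelow (insert h {u : ℝ | t₀ ≤ u ∧ u < h ∧ m ≤ x.mode u}) := by
  refine ⟨t₀, ?_⟩
  rintro u (rfl | hu)
  · exact E.lt.le
  · exact hu.1

theorem entry_le (E : Episode τ x t₀ h) (m : ℕ) : x.entry t₀ h m ≤ h :=
  csInf_le (E.bddBelow m) (Set.mem_insert _ _)

theorem le_entry (E : Episode τ x t₀ h) (m : ℕ) : t₀ ≤ x.entry t₀ h m := by
  refine le_csInf (Set.insert_nonempty _ _) ?_
  rintro u (rfl | hu)
  · exact E.lt.le
  · exact hu.1

theorem entry_mono (E : Episode τ x t₀ h) {m m' : ℕ} (hm : m ≤ m') :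
    x.entry t₀ h m ≤ x.entry t₀ h m' :=
  csInf_le_csInf (E.bddBelow m) (Set.insert_nonempty _ _)
    (Set.insert_subset_insert fun _ hu => ⟨hu.1, hu.2.1, hm.trans hu.2.2⟩)

theorem mode_lt (E : Episode τ x t₀ h) (hu : t₀ ≤ u) (hum : u < x.entry t₀ h m) :
    x.mode u < m := by
  by_contra hle
  exact absurd (csInf_le (E.bddBelow m)
    (Set.mem_insert_of_mem _ ⟨hu, hum.trans_le (E.entry_le m), not_lt.1 hle⟩)) (not_le.2 hum)

theorem le_mode (E : Episode τ x t₀ h) (hu : x.entry t₀ h m < u) (huh : u < h) :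
    m ≤ x.mode u := by
  obtain ⟨v, hv, hvu⟩ := exists_lt_of_csInf_lt (Set.insert_nonempty _ _) hu
  rcases hv with rfl | hv
  · exact absurd hvu (not_lt.2 huh.le)
  · exact hv.2.2.trans (E.mode_mono v u hv.1 hvu.le huh)

theorem entry_one (E : Episode τ x t₀ h) : x.entry t₀ h 1 = t₀ := by
  refine le_antisymm (csInf_le (E.bddBelow 1) (Set.mem_insert_of_mem _ ⟨le_rfl, E.lt, ?_⟩))
    (E.le_entry 1)
  exact (E.run.mode_iff t₀ (by positivity) 1).2 (Or.inl le_rfl)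

theorem nonneg (_ : Episode τ x t₀ h) (hu : t₀ ≤ u) : 0 ≤ u :=
  le_trans (by positivity : (0 : ℝ) ≤ t₀) hu

theorem pending (E : Episode τ x t₀ h) (hJ : x.Unfinished t₀ J u)
    (hu : u < x.entry t₀ h (m + 1)) (hm : m ≤ (τ J.1).L) : Pending τ x J u := by
  refine ⟨hJ.1, hJ.2.2.1, hJ.2.2.2, fun s hs hsu => ?_⟩
  have := E.mode_lt (hJ.start_le.trans hs) (hsu.trans_lt hu)
  omega

theorem unfinished_of_sched (E : Episode τ x t₀ h) (hu : t₀ ≤ u) (hJ : x.sched u = some J) :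
    x.Unfinished t₀ J u := by
  have hp := E.run.pending_of_sched (E.nonneg hu) hJ
  refine ⟨hp.1, ?_, hp.2.1, hp.2.2.1⟩
  by_contra hlt
  push Not at hlt
  exact E.fresh J hlt (hp.of_le (by exact_mod_cast hlt.le) hu)

theorem le_level_of_sched (E : Episode τ x t₀ h) (hu : x.entry t₀ h m < u) (huh : u < h)
    (hJ : x.sched u = some J) : m ≤ (τ J.1).L := by
  have hu0 := E.nonneg ((E.le_entry m).trans hu.le)
  have hp := E.run.pending_of_sched hu0 hJ
  exact (E.le_mode hu huh).trans (hp.2.2.2 u hp.2.1 le_rfl)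

theorem edf (E : Episode τ x t₀ h) (hu : x.entry t₀ h m < u) (hu' : u < x.entry t₀ h (m + 1))
    (hJ : x.sched u = some J) {K : MCJob n} (hK : x.Unfinished t₀ K u) (hm : m ≤ (τ K.1).L) :
    J.2 + (τ J.1).V m ≤ K.2 + (τ K.1).V m := by
  have hu0 := (E.le_entry m).trans hu.le
  have hmode : x.mode u = m := by
    have h1 := E.le_mode hu (hu'.trans_le (E.entry_le _))
    have h2 := E.mode_lt hu0 hu'
    omega
  have := (E.run.edf u (E.nonneg hu0) J hJ).2 K (E.pending hK hu' hm)
  rwa [hmode] at this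

/-- In a mode up to `m`, an unfinished job has not used up its level-`m` budget. -/
theorem executed_lt (E : Episode τ x t₀ h) (hJ : x.Unfinished t₀ J u)
    (hu : u < x.entry t₀ h (m + 1)) (hm : m ≤ (τ J.1).L) :
    x.executed J u < (τ J.1).C m := by
  rcases hm.eq_or_lt with hL | hL
  · rw [hL]
    exact (not_le.1 hJ.2.2.2).trans_le (E.run.demand_le J)
  · by_contra hge
    push Not at hge
    have hu0 := hJ.start_le.trans hJ.2.2.1
    have h1 := (E.run.mode_iff u (E.nonneg hu0) (m + 1)).2
      (Or.inr ⟨u, E.nonneg hu0, le_rfl, fun v h1 h2 => absurd h1 (not_lt.2 h2), J,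
        E.pending hJ hu hm, hL, by simpa using hge⟩)
    have := E.mode_lt hu0 hu
    omega

theorem executed_le (E : Episode τ x t₀ h) (hJ : t₀ ≤ J.2)
    (hu : u ≤ x.entry t₀ h (m + 1)) (hm : m ≤ (τ J.1).L) :
    x.executed J u ≤ (τ J.1).C m := by
  refine executed_le_of_stops (E.run.measurable J) (by positivity) ?_
  intro s hs0 hsu hs v hsv hvu hv
  have hp := E.run.pending_of_sched (hs0.trans hsv.le) hv
  have hun : x.Unfinished t₀ J v := ⟨hp.1, hJ, hp.2.1, hp.2.2.1⟩
  have h1 := E.executed_lt hun (hvu.trans_le hu) hm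
  have h2 : x.executed J s ≤ x.executed J v := executed_mono hsv.le
  linarith

end Episode

/-- Every interval in which some job remains pending ends an episode: it starts at the last integer
at which all work released before was done. -/
theorem exists_episode (hx : x.IsEDFRun τ) (hh : (J.2 : ℝ) < h)
    (hJ : ∀ u : ℝ, J.2 ≤ u → u < h → Pending τ x J u) :
    ∃ t₀ : ℕ, t₀ ≤ J.2 ∧ Episode τ x t₀ h := by
  classical
  set fresh : ℕ → Prop := fun k => ∀ K : MCJob n, K.2 < k → ¬ Pending τ x K k with hfresh
  have hfresh0 : fresh 0 := fun K hK => absurd hK (by omega)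
  set t₀ := Nat.findGreatest fresh J.2 with ht₀
  have hle : t₀ ≤ J.2 := Nat.findGreatest_le _
  have ht₀f : fresh t₀ := Nat.findGreatest_spec (P := fresh) (Nat.zero_le _) hfresh0
  have hmax : ∀ k, t₀ < k → k ≤ J.2 → ¬ fresh k := fun k hk hk' =>
    Nat.findGreatest_is_greatest hk hk'
  have hleR : (t₀ : ℝ) ≤ J.2 := by exact_mod_cast hle
  -- some earlier released job is pending throughout the interior of the episode
  have hpend : ∀ u : ℝ, t₀ < u → u < h → ∃ K : MCJob n, (K.2 : ℝ) < u ∧ Pending τ x K u := by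
    intro u hu huh
    rcases lt_or_ge (J.2 : ℝ) u with hlt | hge
    · exact ⟨J, hlt, hJ u hlt.le huh⟩
    · have hk1 : t₀ < ⌈u⌉₊ := Nat.lt_ceil.2 hu
      have hk2 : ⌈u⌉₊ ≤ J.2 := Nat.ceil_le.2 hge
      have := hmax _ hk1 hk2
      simp only [hfresh, not_forall, not_not] at this
      obtain ⟨K, hK, hKp⟩ := this
      have hKu := Nat.lt_ceil.1 hK
      exact ⟨K, hKu, hKp.of_le hKu.le (Nat.le_ceil u)⟩
  have hpend' : ∀ u : ℝ, t₀ ≤ u → u < h → ∃ K : MCJob n, Pending τ x K u := by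
    intro u hu huh
    rcases hu.lt_or_eq with hlt | rfl
    · obtain ⟨K, -, hK⟩ := hpend u hlt huh
      exact ⟨K, hK⟩
    · rcases hle.lt_or_eq with hlt | heq
      · have := hmax (t₀ + 1) (by omega) hlt
        simp only [hfresh, not_forall, not_not] at this
        obtain ⟨K, hK, hKp⟩ := this
        exact ⟨K, hKp.of_le (by exact_mod_cast Nat.lt_succ_iff.1 hK) (by push_cast; linarith)⟩
      · exact ⟨J, hJ _ (by rw [heq]) huh⟩
  refine ⟨t₀, hle, hx, hleR.trans_lt hh, ht₀f, fun u hu huh => ?_, fun u v hu huv hvh => ?_⟩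
  · have hu0 : 0 ≤ u := le_trans (by positivity : (0 : ℝ) ≤ t₀) hu
    obtain ⟨K, hK⟩ := hpend' u hu huh
    cases hs : x.sched u with
    | none => exact absurd hK (hx.work_conserving u hu0 hs K)
    | some I => exact ⟨I, rfl⟩
  · have hu0 : 0 ≤ u := le_trans (by positivity : (0 : ℝ) ≤ t₀) hu
    rw [hx.mode_iff v (hu0.trans huv)]
    rcases (hx.mode_iff u hu0 (x.mode u)).1 le_rfl with h1 | ⟨s, hs0, hsu, hres, K, hK⟩
    · exact Or.inl h1
    · refine Or.inr ⟨s, hs0, hsu.trans huv, fun w hsw hwv hw => ?_, K, hK⟩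
      rcases le_or_gt w u with hwu | hwu
      · exact hres w hsw hwu hw
      · obtain ⟨I, hI1, hI2⟩ := hpend w (hu.trans_lt hwu) (hwv.trans_lt hvh)
        exact (hx.reset_idle w hw).2 I hI1 hI2

/-! ### Residual demand -/

open Classical in
/-- The jobs released by time `h`. -/
noncomputable def jobsUpTo (x : MCTrace n) (h : ℝ) : Finset (MCJob n) :=
  {J ∈ (Finset.univ : Finset (Fin n)) ×ˢ Finset.range (⌈h⌉₊ + 1) | J.2 ∈ x.releases J.1}

theorem mem_jobsUpTo (hJ : J.2 ∈ x.releases J.1) (hJh : (J.2 : ℝ) ≤ h) : J ∈ x.jobsUpTo h := by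
  classical
  rw [jobsUpTo, Finset.mem_filter, Finset.mem_product, Finset.mem_range]
  refine ⟨⟨Finset.mem_univ _, ?_⟩, hJ⟩
  have : J.2 ≤ ⌈h⌉₊ := by exact_mod_cast hJh.trans (Nat.le_ceil h)
  omega

theorem release_of_mem_jobsUpTo (hJ : J ∈ x.jobsUpTo h) : J.2 ∈ x.releases J.1 := by
  classical
  rw [jobsUpTo, Finset.mem_filter] at hJ
  exact hJ.2

open Classical in
/-- Worst-case execution demand that job `J` still has at time `t` up to its level-`m` budget, if
its level-`m` virtual deadline is at most `d`. -/
noncomputable def residual (τ : Fin n → MCTask) (x : MCTrace n) (t₀ m : ℕ) (t : ℝ) (d : ℤ)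
    (J : MCJob n) : ℝ :=
  if x.Unfinished t₀ J t ∧ m ≤ (τ J.1).L ∧ (J.2 : ℤ) + (τ J.1).V m ≤ d then
    (τ J.1).C m - x.executed J t else 0

/-- While the mode is `m` (and also at the instants at which it is entered and left), the residual
level-`m` demand of all jobs with virtual deadlines up to `d` fits into the time left until `d`. -/
def Fits (τ : Fin n → MCTask) (x : MCTrace n) (t₀ : ℕ) (h : ℝ) (m : ℕ) : Prop :=
  ∀ t : ℝ, x.entry t₀ h m ≤ t → t ≤ x.entry t₀ h (m + 1) → ∀ d : ℤ, t ≤ d →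
    ∑ J ∈ x.jobsUpTo h, residual τ x t₀ m t d J ≤ d - t

/-- Until mode `m` is left, no unfinished job is past its level-`m` virtual deadline. -/
def Timely (τ : Fin n → MCTask) (x : MCTrace n) (t₀ : ℕ) (h : ℝ) (m : ℕ) : Prop :=
  ∀ u : ℝ, t₀ ≤ u → u < x.entry t₀ h (m + 1) → ∀ J, x.Unfinished t₀ J u → m ≤ (τ J.1).L →
    u < J.2 + (τ J.1).V m

namespace Episode

theorem residual_nonneg (E : Episode τ x t₀ h) (ht : t ≤ x.entry t₀ h (m + 1))
    {d : ℤ} (J : MCJob n) : 0 ≤ residual τ x t₀ m t d J := by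
  rw [residual]
  split_ifs with hJ
  · exact sub_nonneg.2 (E.executed_le hJ.1.2.1 ht hJ.2.1)
  · exact le_rfl

theorem mem_jobsUpTo (E : Episode τ x t₀ h) (hJ : x.Unfinished t₀ J t)
    (ht : t ≤ x.entry t₀ h (m + 1)) : J ∈ x.jobsUpTo h :=
  MCTrace.mem_jobsUpTo hJ.1 (hJ.2.2.1.trans (ht.trans (E.entry_le _)))

theorem residual_le (E : Episode τ x t₀ h) (hfit : Fits τ x t₀ h m)
    (ht : x.entry t₀ h m ≤ t) (ht' : t ≤ x.entry t₀ h (m + 1)) {d : ℤ} (htd : t ≤ d)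
    (hJ : x.Unfinished t₀ J t) (hL : m ≤ (τ J.1).L) (hd : (J.2 : ℤ) + (τ J.1).V m ≤ d) :
    (τ J.1).C m - x.executed J t ≤ d - t := by
  have h1 := Finset.single_le_sum (f := residual τ x t₀ m t d)
    (fun K _ => E.residual_nonneg ht' K) (E.mem_jobsUpTo hJ ht')
  rw [residual, if_pos ⟨hJ, hL, hd⟩] at h1
  exact h1.trans (hfit t ht ht' d htd)

theorem residual_add_le (E : Episode τ x t₀ h) (hfit : Fits τ x t₀ h m)
    (ht : x.entry t₀ h m ≤ t) (ht' : t ≤ x.entry t₀ h (m + 1)) {d : ℤ} (htd : t ≤ d) {K : MCJob n}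
    (hJK : J ≠ K) (hJ : x.Unfinished t₀ J t) (hL : m ≤ (τ J.1).L)
    (hd : (J.2 : ℤ) + (τ J.1).V m ≤ d) (hK : x.Unfinished t₀ K t) (hLK : m ≤ (τ K.1).L)
    (hdK : (K.2 : ℤ) + (τ K.1).V m ≤ d) :
    ((τ J.1).C m - x.executed J t) + ((τ K.1).C m - x.executed K t) ≤ d - t := by
  have h1 := Finset.add_le_sum (f := residual τ x t₀ m t d)
    (fun K _ => E.residual_nonneg ht' K) (E.mem_jobsUpTo hJ ht') (E.mem_jobsUpTo hK ht') hJK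
  rw [residual, if_pos ⟨hJ, hL, hd⟩, residual, if_pos ⟨hK, hLK, hdK⟩] at h1
  exact h1.trans (hfit t ht ht' d htd)

theorem timely_zero (E : Episode τ x t₀ h) : Timely τ x t₀ h 0 := by
  intro u hu hu'
  rw [zero_add, E.entry_one] at hu'
  exact absurd hu' (not_lt.2 hu)

theorem timely_succ (E : Episode τ x t₀ h) (htl : Timely τ x t₀ h m)
    (hfit : Fits τ x t₀ h (m + 1)) : Timely τ x t₀ h (m + 1) := by
  intro u hu hu' J hJ hL
  by_contra hge
  push Not at hge
  have hV : ((τ J.1).V m : ℝ) ≤ (τ J.1).V (m + 1) := by exact_mod_cast (τ J.1).V_le_succ hL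
  set v : ℝ := (J.2 : ℝ) + (τ J.1).V (m + 1) with hv
  have hrv : (J.2 : ℝ) ≤ v := by
    have : (0 : ℝ) ≤ (τ J.1).V (m + 1) := by positivity
    linarith
  have hJv := hJ.of_le hrv hge
  rcases lt_or_ge v (x.entry t₀ h (m + 1)) with hlt | hle
  · have := htl v (hJv.start_le.trans hrv) hlt J hJv (by omega)
    linarith
  · have h1 := E.residual_le hfit hle (hge.trans hu'.le)
      (d := (J.2 : ℤ) + (τ J.1).V (m + 1)) (by push_cast; linarith) hJv hL le_rfl
    have h2 := E.executed_lt hJv (hge.trans_lt hu') hL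
    push_cast at h1
    linarith

end Episode

end MCTrace

/-! ### Demand up to a virtual deadline -/

namespace MCTrace

variable {n : ℕ} {τ : Fin n → MCTask} {x : MCTrace n} {J : MCJob n} {t₀ : ℕ} {h t u : ℝ} {m k : ℕ}
  {d : ℤ} {β : ℝ}

/-- The job that runs at time `u`, in mode `k` or `k + 1`, has a virtual deadline of at most `d`. -/
def Urgent (τ : Fin n → MCTask) (x : MCTrace n) (t₀ : ℕ) (h : ℝ) (k : ℕ) (d : ℤ) (u : ℝ) : Prop :=
  ∀ J : MCJob n, x.sched u = some J →
    (u < x.entry t₀ h (k + 1) → (J.2 : ℤ) + (τ J.1).V k ≤ d) ∧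
    (x.entry t₀ h (k + 1) < u → (J.2 : ℤ) + (τ J.1).V (k + 1) ≤ d)

/-- The demand of job `J` in `[β, d)`: what it executes in `[β, t)` and its residual at `t`. -/
noncomputable def weight (τ : Fin n → MCTask) (x : MCTrace n) (t₀ m : ℕ) (β t : ℝ) (d : ℤ)
    (J : MCJob n) : ℝ :=
  x.ran J β t + residual τ x t₀ m t d J

theorem residual_eq_zero (hJ : ¬ (x.Unfinished t₀ J t ∧ m ≤ (τ J.1).L ∧
    (J.2 : ℤ) + (τ J.1).V m ≤ d)) : residual τ x t₀ m t d J = 0 :=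
  if_neg hJ

namespace Episode

/-- Either the processor runs urgent jobs only, ever since mode `k` was entered, or it has done so
since some integer `b`, and then none of the urgent jobs was released before `b`. -/
theorem busy_start (E : Episode τ x t₀ h)
    (ht : t ≤ x.entry t₀ h (k + 2)) (d : ℤ) :
    (∀ u, x.entry t₀ h k < u → u < t → u ≠ x.entry t₀ h (k + 1) → Urgent τ x t₀ h k d u) ∨
    ∃ b : ℤ, x.entry t₀ h k < b ∧
      (∀ u, (b : ℝ) < u → u < t → u ≠ x.entry t₀ h (k + 1) → Urgent τ x t₀ h k d u) ∧
      ∀ J : MCJob n, (J.2 : ℤ) < b → residual τ x t₀ (k + 1) t d J = 0 ∧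
        ∀ u, (b : ℝ) < u → u < t → u ≠ x.entry t₀ h (k + 1) → x.sched u ≠ some J := by
  by_cases hall : ∀ u, x.entry t₀ h k < u → u < t → u ≠ x.entry t₀ h (k + 1) →
      Urgent τ x t₀ h k d u
  · exact Or.inl hall
  right
  push Not at hall
  obtain ⟨z, ⟨u, hOu, hut, huS, hnu, hz⟩, hmax⟩ := Int.exists_greatest_of_bdd
    (P := fun z => ∃ u, x.entry t₀ h k < u ∧ u < t ∧ u ≠ x.entry t₀ h (k + 1) ∧
      ¬ Urgent τ x t₀ h k d u ∧ ⌊u⌋ = z)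
    ⟨⌊t⌋, by
      rintro z ⟨u, -, hu, -, -, rfl⟩
      exact Int.floor_mono hu.le⟩
    (by
      obtain ⟨u, h1, h2, h3, h4⟩ := hall
      exact ⟨_, u, h1, h2, h3, h4, rfl⟩)
  have hub : u < ((z + 1 : ℤ) : ℝ) := by
    rw [← hz]
    push_cast
    exact Int.lt_floor_add_one u
  have hurg : ∀ v, ((z + 1 : ℤ) : ℝ) < v → v < t → v ≠ x.entry t₀ h (k + 1) →
      Urgent τ x t₀ h k d v := by
    intro v hv hvt hvS
    by_contra hn
    have h1 := hmax _ ⟨v, hOu.trans (hub.trans hv), hvt, hvS, hn, rfl⟩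
    have h2 : z + 1 ≤ ⌊v⌋ := Int.le_floor.2 hv.le
    omega
  -- an unfinished job released before `u` is not more urgent than the job running at `u`
  have hkey : ∀ J : MCJob n, (J.2 : ℤ) < z + 1 → x.Unfinished t₀ J u → k ≤ (τ J.1).L →
      (u < x.entry t₀ h (k + 1) ∧ d < (J.2 : ℤ) + (τ J.1).V k) ∨
      (x.entry t₀ h (k + 1) < u ∧ (k + 1 ≤ (τ J.1).L → d < (J.2 : ℤ) + (τ J.1).V (k + 1))) := by
    intro J hJz hJu hL
    simp only [Urgent, not_forall] at hnu
    obtain ⟨I, hI, hIn⟩ := hnu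
    rcases lt_or_gt_of_ne huS with hlt | hgt
    · left
      refine ⟨hlt, ?_⟩
      have h1 := E.edf hOu hlt hI hJu hL
      have h2 : ¬ ((I.2 : ℤ) + (τ I.1).V k ≤ d) := fun hle =>
        hIn ⟨fun _ => hle, fun hlt' => absurd hlt' (not_lt.2 hlt.le)⟩
      omega
    · right
      refine ⟨hgt, fun hL' => ?_⟩
      have h1 := E.edf hgt (hut.trans_le ht) hI hJu hL'
      have h2 : ¬ ((I.2 : ℤ) + (τ I.1).V (k + 1) ≤ d) := fun hle =>
        hIn ⟨fun hlt' => absurd hlt' (not_lt.2 hgt.le), fun _ => hle⟩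
      omega
  have hrel : ∀ J : MCJob n, (J.2 : ℤ) < z + 1 → (J.2 : ℝ) ≤ u := by
    intro J hJ
    have : (J.2 : ℤ) ≤ ⌊u⌋ := by omega
    exact_mod_cast Int.le_floor.1 this
  refine ⟨z + 1, hOu.trans hub, hurg, fun J hJ => ⟨residual_eq_zero ?_, fun v hv hvt hvS hs => ?_⟩⟩
  · rintro ⟨hun, hL, hd⟩
    have hV : (τ J.1).V k ≤ (τ J.1).V (k + 1) := (τ J.1).V_le_succ hL
    rcases hkey J hJ (hun.of_le (hrel J hJ) hut.le) (by omega) with ⟨-, h1⟩ | ⟨-, h1⟩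
    · omega
    · have := h1 hL
      omega
  · have hOv := hOu.trans (hub.trans hv)
    have hun := E.unfinished_of_sched ((E.le_entry k).trans hOv.le) hs
    have hvh : v < h := hvt.trans_le (ht.trans (E.entry_le _))
    have hu := hurg v hv hvt hvS J hs
    rcases hkey J hJ (hun.of_le (hrel J hJ) (hub.trans hv).le) (E.le_level_of_sched hOv hvh hs)
      with ⟨h0, h1⟩ | ⟨h0, h1⟩
    · rcases lt_or_gt_of_ne hvS with hlt | hgt
      · have := hu.1 hlt
        omega
      · have hL := E.le_level_of_sched hgt hvh hs
        have hV : (τ J.1).V k ≤ (τ J.1).V (k + 1) := (τ J.1).V_le_succ hL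
        have := hu.2 hgt
        omega
    · have hgt := h0.trans (hub.trans hv)
      have := h1 (E.le_level_of_sched hgt hvh hs)
      have := hu.2 hgt
      omega

/-- Sporadic separation of the jobs of an episode. -/
theorem separated (E : Episode τ x t₀ h) : ∀ J ∈ x.jobsUpTo h, ∀ J' ∈ x.jobsUpTo h, J.1 = J'.1 →
    J.2 < J'.2 → J.2 + (τ J.1).T ≤ J'.2 := by
  intro J hJ J' hJ' he hlt
  have h1 := release_of_mem_jobsUpTo hJ
  have h2 := release_of_mem_jobsUpTo hJ'
  rw [← he] at h2
  exact E.run.sporadic J.1 J.2 h1 J'.2 h2 hlt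

theorem sub_le_sum_ran (E : Episode τ x t₀ h) (hβ : t₀ ≤ β) (hβt : β ≤ t) (hth : t ≤ h) :
    t - β ≤ ∑ J ∈ x.jobsUpTo h, x.ran J β t := by
  refine MCTrace.sub_le_sum_ran hβt (p := t) fun u hu hut _ => ?_
  obtain ⟨J, hJ⟩ := E.busy u (hβ.trans hu.le) (hut.trans_le hth)
  have hun := E.unfinished_of_sched (hβ.trans hu.le) hJ
  exact ⟨J, MCTrace.mem_jobsUpTo hun.1 (hun.2.2.1.trans (hut.le.trans hth)), hJ⟩

theorem ran_le_max (E : Episode τ x t₀ h) {a b : ℝ} (ha : t₀ ≤ a) :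
    x.ran J a b ≤ max 0 (b - max a J.2) := by
  have hnone : ∀ u, a < u → u < J.2 → x.sched u ≠ some J := fun u hu huJ hs =>
    absurd (E.run.pending_of_sched (E.nonneg (ha.trans hu.le)) hs).2.1 (not_le.2 huJ)
  rcases le_or_gt b (max a J.2) with hb | hb
  · rw [ran_eq_zero]
    · exact le_max_left _ _
    · intro u hu hub
      rcases le_max_iff.1 hb with h | h
      · linarith
      · exact hnone u hu (hub.trans_le h)
  · rw [ran_add (E.run.measurable J) (le_max_left a (J.2 : ℝ)) hb.le, ran_eq_zero (b := max a J.2),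
      zero_add]
    · exact (ran_le hb.le).trans (le_max_right _ _)
    · intro u hu hub
      rcases lt_max_iff.1 hub with h | h
      · linarith
      · exact hnone u hu h

section weight

theorem weight_le (E : Episode τ x t₀ h) (hJ : t₀ ≤ J.2) (hL : m ≤ (τ J.1).L)
    (hβ : t₀ ≤ β) (hβt : β ≤ t) (ht : t ≤ x.entry t₀ h (m + 1)) :
    weight τ x t₀ m β t d J ≤ (τ J.1).C m - x.executed J β := by
  have h1 := executed_add_ran (E.run.measurable J) (E.nonneg hβ) hβt
  have h2 := E.executed_le hJ ht hL
  rw [weight, residual]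
  split_ifs <;> linarith

theorem weight_eq_zero_of_finished (E : Episode τ x t₀ h) (hβ : t₀ ≤ β) (hβt : β ≤ t)
    (hf : x.Finished J β) : weight τ x t₀ m β t d J = 0 := by
  rw [weight, E.run.ran_eq_zero_of_finished (E.nonneg hβ) hf, zero_add]
  exact residual_eq_zero fun hn => hn.1.2.2.2 (hf.mono hβt)

/-- A job that is finished before mode `m + 1` is entered demands no more than its level-`m`
budget. -/
theorem weight_le_of_finished (E : Episode τ x t₀ h) (hJ : t₀ ≤ J.2) (hL : m ≤ (τ J.1).L)
    {m' : ℕ} (hβ : t₀ ≤ β) (hβt : β ≤ t) (hut : u ≤ t) (hu0 : t₀ ≤ u)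
    (hu : u ≤ x.entry t₀ h (m + 1)) (hf : x.Finished J u) :
    weight τ x t₀ m' β t d J ≤ (τ J.1).C m - x.executed J β := by
  have h1 := executed_add_ran (E.run.measurable J) (E.nonneg hβ) hβt
  have h2 := E.executed_le hJ hu hL
  have h3 := E.run.executed_eq_of_finished (E.nonneg hu0) hut hf
  rw [weight, residual_eq_zero fun hn => hn.1.2.2.2 (hf.mono hut)]
  linarith

theorem weight_le_of_early (E : Episode τ x t₀ h) (htl : Timely τ x t₀ h m)
    (hrel : J.2 ∈ x.releases J.1) (hJ : t₀ ≤ J.2) (hL : m ≤ (τ J.1).L)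
    (hβ : t₀ ≤ β) (hβt : β ≤ t) (hSt : x.entry t₀ h (m + 1) ≤ t) {m' : ℕ}
    (hearly : (J.2 : ℝ) + (τ J.1).V m < x.entry t₀ h (m + 1)) :
    weight τ x t₀ m' β t d J ≤ (τ J.1).C m - x.executed J β := by
  have hr : (J.2 : ℝ) ≤ J.2 + (τ J.1).V m := by
    have : (0 : ℝ) ≤ (τ J.1).V m := by positivity
    linarith
  have h0 : (t₀ : ℝ) ≤ J.2 + (τ J.1).V m := le_trans (by exact_mod_cast hJ) hr
  refine E.weight_le_of_finished hJ hL hβ hβt (hearly.le.trans hSt) h0 hearly.le ?_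
  by_contra hf
  exact lt_irrefl _ (htl _ h0 hearly J ⟨hrel, hJ, hr, hf⟩ hL)

/-- Only jobs that are urgent at level `k` weigh anything. -/
theorem weight_eq_zero_of_not_urgent (E : Episode τ x t₀ h) (hOβ : x.entry t₀ h k ≤ β)
    (ht : t ≤ x.entry t₀ h (k + 2))
    (hurg : ∀ u, β < u → u < t → u ≠ x.entry t₀ h (k + 1) → Urgent τ x t₀ h k d u)
    (hJ : ¬ (k ≤ (τ J.1).L ∧ (J.2 : ℤ) + (τ J.1).V k ≤ d)) :
    weight τ x t₀ (k + 1) β t d J = 0 := by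
  have hrun : ∀ u, β < u → u < t → u ≠ x.entry t₀ h (k + 1) → x.sched u ≠ some J := by
    intro u hu hut huS hs
    have huh : u < h := hut.trans_le (ht.trans (E.entry_le _))
    have hL := E.le_level_of_sched (hOβ.trans_lt hu) huh hs
    have := hurg u hu hut huS J hs
    rcases lt_or_gt_of_ne huS with hlt | hgt
    · exact hJ ⟨hL, this.1 hlt⟩
    · have hL' := E.le_level_of_sched hgt huh hs
      have hV : (τ J.1).V k ≤ (τ J.1).V (k + 1) := (τ J.1).V_le_succ hL'
      have := this.2 hgt
      exact hJ ⟨hL, by omega⟩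
  rw [weight, residual_eq_zero, add_zero]
  · exact ran_eq_zero_of_ne hrun
  · rintro ⟨-, hL, hd⟩
    have hV : (τ J.1).V k ≤ (τ J.1).V (k + 1) := (τ J.1).V_le_succ hL
    exact hJ ⟨by omega, by omega⟩

/-- A job that is not urgent at level `k + 1` executes only before mode `k + 1` is entered. -/
theorem weight_le_ran (E : Episode τ x t₀ h)
    (hSt : x.entry t₀ h (k + 1) ≤ t) (ht : t ≤ x.entry t₀ h (k + 2))
    (hurg : ∀ u, β < u → u < t → u ≠ x.entry t₀ h (k + 1) → Urgent τ x t₀ h k d u)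
    (hJ : ¬ (k + 1 ≤ (τ J.1).L ∧ (J.2 : ℤ) + (τ J.1).V (k + 1) ≤ d)) :
    weight τ x t₀ (k + 1) β t d J ≤ x.ran J β (x.entry t₀ h (k + 1)) := by
  have hrun : ∀ u, β < u → u < t → x.entry t₀ h (k + 1) < u → x.sched u ≠ some J := by
    intro u hu hut huS hs
    have huh : u < h := hut.trans_le (ht.trans (E.entry_le _))
    exact hJ ⟨E.le_level_of_sched huS huh hs, (hurg u hu hut huS.ne' J hs).2 huS⟩
  rw [weight, residual_eq_zero (fun hn => hJ hn.2), add_zero]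
  rcases le_or_gt (x.entry t₀ h (k + 1)) β with hle | hlt
  · rw [ran_eq_zero fun u hu hut => hrun u hu hut (hle.trans_lt hu)]
    exact ran_nonneg
  · rw [ran_add (E.run.measurable J) hlt.le hSt,
      ran_eq_zero (a := x.entry t₀ h (k + 1)) fun u hu hut => hrun u (hlt.trans hu) hut hu, add_zero]

end weight

end Episode

end MCTrace

/-! ### Induction on the mode -/

namespace MCTrace

variable {n : ℕ} {τ : Fin n → MCTask} {x : MCTrace n} {t₀ : ℕ} {h t : ℝ} {m k : ℕ} {d : ℤ} {β : ℝ}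

namespace Episode

/-- If a job `I` whose level-`m` virtual deadline is `c = ⌈S⌉` remains unfinished until mode `m + 1`
is entered at `S`, then any other job executes in `[β, S)` no longer than it could until `c - 1`:
the residual demands of both jobs fit together, and that of `I` is positive. -/
theorem ran_le_of_unfinished (E : Episode τ x t₀ h) (hm : 1 ≤ m) (hfit : Fits τ x t₀ h m)
    (hOβ : x.entry t₀ h m ≤ β) {I K : MCJob n} {c : ℤ} (hI : (I.2 : ℤ) + (τ I.1).V m = c)
    (hIL : m ≤ (τ I.1).L) (hIβ : β ≤ I.2)
    (hIun : ∀ u : ℝ, I.2 ≤ u → u < x.entry t₀ h (m + 1) → x.Unfinished t₀ I u)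
    (hIS : (I.2 : ℝ) < x.entry t₀ h (m + 1)) (hSc : x.entry t₀ h (m + 1) ≤ c)
    (hKI : K ≠ I) (hK : K.2 ∈ x.releases K.1)
    (hKt : t₀ ≤ K.2) (hKL : m ≤ (τ K.1).L) :
    x.ran K β (x.entry t₀ h (m + 1)) ≤ max 0 ((c - 1 : ℤ) - max β K.2) := by
  set S := x.entry t₀ h (m + 1) with hS
  have hβ0 : t₀ ≤ β := (E.le_entry m).trans hOβ
  have hβS : β ≤ S := hIβ.trans hIS.le
  have hmeas := E.run.measurable K
  have hIc : (I.2 : ℝ) ≤ (c - 1 : ℤ) := by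
    have h1 := (τ I.1).V_pos hm hIL
    exact_mod_cast (by omega : (I.2 : ℤ) ≤ c - 1)
  rcases le_or_gt S K.2 with hKS | hKS
  · refine E.ran_le_max hβ0 |>.trans (max_le (le_max_left _ _) ?_)
    exact (sub_nonpos.2 (hKS.trans (le_max_right _ _))).trans (le_max_left _ _)
  have hKc : (K.2 : ℝ) ≤ (c - 1 : ℤ) := by
    have : (K.2 : ℝ) < c := hKS.trans_le hSc
    have : (K.2 : ℤ) < c := by exact_mod_cast this
    exact_mod_cast (by omega : (K.2 : ℤ) ≤ c - 1)
  rcases lt_or_ge c ((K.2 : ℤ) + (τ K.1).V m) with hlate | hearly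
  · -- `K` has a later deadline than `I`, and so it does not run once `I` is released
    rw [ran_add hmeas hIβ hIS.le, ran_eq_zero (a := (I.2 : ℝ)), add_zero]
    · exact (E.ran_le_max hβ0).trans (max_le_max le_rfl (by linarith))
    · intro u hu huS hs
      have := E.edf (hOβ.trans_lt (hIβ.trans_lt hu)) huS hs (hIun u hu.le huS) hIL
      omega
  set v : ℝ := max I.2 K.2 with hv
  have hvS : v < S := max_lt hIS hKS
  have hβv : β ≤ v := hIβ.trans (le_max_left _ _)
  have hvc : v ≤ (c - 1 : ℤ) := max_le hIc hKc
  rw [ran_add hmeas hβv hvS.le]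
  by_cases hKf : x.Finished K v
  · rw [E.run.ran_eq_zero_of_finished (E.nonneg (hβ0.trans hβv)) hKf, add_zero]
    exact (E.ran_le_max hβ0).trans (max_le_max le_rfl (by linarith))
  have hKun : x.Unfinished t₀ K v := ⟨hK, hKt, le_max_right _ _, hKf⟩
  have hIv := hIun v (le_max_left _ _) hvS
  have hpair := E.residual_add_le hfit (hOβ.trans hβv) hvS.le (d := c) (hvS.le.trans hSc) hKI
    hKun hKL hearly hIv hIL hI.le
  have hIlt := E.executed_lt hIv hvS hIL
  have hKle := E.executed_le hKt hS.le hKL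
  have hKadd := executed_add_ran hmeas (E.nonneg (hβ0.trans hβv)) hvS.le
  rcases le_or_gt (K.2 : ℝ) I.2 with hle | hgt
  · have hvI : v = I.2 := max_eq_left hle
    rw [hvI] at hpair hKadd ⊢
    rw [E.run.executed_eq_zero (J := I) le_rfl] at hpair
    have h1 : (1 : ℝ) ≤ (τ I.1).C m := by exact_mod_cast (τ I.1).C_pos hm hIL
    have h2 := E.ran_le_max (J := K) (b := (I.2 : ℝ)) hβ0
    rw [max_eq_right (sub_nonneg.2 (max_le hIβ hle))] at h2
    refine le_trans ?_ (le_max_right _ _)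
    push_cast
    linarith
  · have hvK : v = K.2 := max_eq_right hgt.le
    rw [hvK] at hpair hKadd hβv ⊢
    rw [E.run.executed_eq_zero (J := K) le_rfl] at hpair hKadd
    have h2 := E.ran_le_max (J := K) (b := (K.2 : ℝ)) hβ0
    rw [max_eq_right hβv, sub_self, max_self] at h2
    rw [max_eq_right hβv]
    have h3 : ((τ K.1).C m : ℝ) ≤ (c - 1 : ℤ) - K.2 := by
      have : ((τ K.1).C m : ℝ) < c - K.2 := by
        rw [hvK] at hIlt
        linarith
      have : ((τ K.1).C m : ℤ) < c - K.2 := by exact_mod_cast this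
      exact_mod_cast (by omega : ((τ K.1).C m : ℤ) ≤ c - 1 - K.2)
    refine le_trans ?_ (le_max_right _ _)
    linarith

/-- The integer `S'` that stands for the instant at which mode `m + 1` is entered, for the purpose of
the demand test with origin `o`. It is this instant rounded up, unless some job demands more than
its level-`m` budget although it is followed by a release up to that integer; in this case it is
the instant rounded down. -/
theorem exists_switch (E : Episode τ x t₀ h) (hm : 1 ≤ m) (hfit : Fits τ x t₀ h m)
    (htl : Timely τ x t₀ h m) (hSt : x.entry t₀ h (m + 1) ≤ t)
    (htd : t ≤ d) {o : ℤ} (hOβ : x.entry t₀ h m ≤ β) (hβt : β ≤ t) (hβo : β ≤ o + 1)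
    (hod : o + 1 ≤ d) :
    ∃ S' : ℤ, o + 1 ≤ S' ∧ S' ≤ d ∧
      (∀ J : MCJob n, o + 1 ≤ (J.2 : ℤ) + (τ J.1).V m → (J.2 : ℤ) + (τ J.1).V m < S' →
        (J.2 : ℝ) + (τ J.1).V m < x.entry t₀ h (m + 1)) ∧
      (∀ K : MCJob n, K.2 ∈ x.releases K.1 → t₀ ≤ K.2 → m ≤ (τ K.1).L →
        ¬ (m + 1 ≤ (τ K.1).L ∧ (K.2 : ℤ) + (τ K.1).V (m + 1) ≤ d) →
        x.ran K β (x.entry t₀ h (m + 1)) ≤ max 0 (S' - max β K.2)) ∧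
      (∀ J : MCJob n, J.2 ∈ x.releases J.1 → t₀ ≤ J.2 → m + 1 ≤ (τ J.1).L → o < J.2 →
        (J.2 : ℤ) + (τ J.1).T ≤ S' → weight τ x t₀ (m + 1) β t d J ≤ (τ J.1).C m) := by
  set S := x.entry t₀ h (m + 1) with hS
  have hβ0 : t₀ ≤ β := (E.le_entry m).trans hOβ
  have hcd : ⌈S⌉ ≤ d := Int.ceil_le.2 (hSt.trans htd)
  by_cases hex : ∃ J : MCJob n, J.2 ∈ x.releases J.1 ∧ t₀ ≤ J.2 ∧ m + 1 ≤ (τ J.1).L ∧ o < J.2 ∧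
      (J.2 : ℤ) + (τ J.1).T ≤ max ⌈S⌉ (o + 1) ∧ ((τ J.1).C m : ℝ) < weight τ x t₀ (m + 1) β t d J
  · obtain ⟨I, hIr, hIt, hIL, hoI, hIT, hIw⟩ := hex
    have hTpos := (τ I.1).T_pos
    have hVT : (τ I.1).V m ≤ (τ I.1).T := (τ I.1).V_le_T (by omega)
    have hIβ : β ≤ I.2 := hβo.trans (by exact_mod_cast (by omega : o + 1 ≤ (I.2 : ℤ)))
    have hge : S ≤ (I.2 : ℝ) + (τ I.1).V m := by
      by_contra hlt
      have := E.weight_le_of_early (d := d) (m' := m + 1) htl hIr hIt (by omega) hβ0 hβt hSt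
        (not_le.1 hlt)
      have := executed_nonneg (x := x) (J := I) (a := β)
      linarith
    have hge' : ⌈S⌉ ≤ (I.2 : ℤ) + (τ I.1).V m := Int.ceil_le.2 (by exact_mod_cast hge)
    have hIc : (I.2 : ℤ) + (τ I.1).V m = ⌈S⌉ := by omega
    have hTc : (I.2 : ℤ) + (τ I.1).T = ⌈S⌉ := by omega
    have hcS : ((⌈S⌉ - 1 : ℤ) : ℝ) < S := by
      have := Int.ceil_lt_add_one S
      push_cast
      linarith
    have hIS : (I.2 : ℝ) < S :=
      lt_of_le_of_lt (by exact_mod_cast (by omega : (I.2 : ℤ) ≤ ⌈S⌉ - 1)) hcS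
    have hIun : ∀ u : ℝ, I.2 ≤ u → u < S → x.Unfinished t₀ I u := by
      intro u hu huS
      refine ⟨hIr, hIt, hu, fun hf => ?_⟩
      have := E.weight_le_of_finished (d := d) (m' := m + 1) hIt (by omega : m ≤ (τ I.1).L) hβ0 hβt
        (huS.le.trans hSt) (le_trans (by exact_mod_cast hIt) hu) huS.le hf
      have := executed_nonneg (x := x) (J := I) (a := β)
      linarith
    have hlt : ∀ z : ℤ, z ≤ ⌈S⌉ - 1 → (z : ℝ) < S := fun z hz =>
      lt_of_le_of_lt (by exact_mod_cast hz) hcS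
    refine ⟨⌈S⌉ - 1, by omega, by omega, fun J _ hJ => ?_, fun K hK hKt hKL hKlow => ?_,
      fun J hJr hJt hJL hoJ hJT => ?_⟩
    · exact_mod_cast hlt _ hJ.le
    · refine E.ran_le_of_unfinished hm hfit hOβ hIc (by omega) hIβ hIun hIS (Int.le_ceil S)
        ?_ hK hKt hKL
      rintro rfl
      refine hKlow ⟨hIL, ?_⟩
      have : (τ K.1).V (m + 1) ≤ (τ K.1).T := (τ K.1).V_le_T hIL
      omega
    · have hV : (τ J.1).V m ≤ (τ J.1).T := (τ J.1).V_le_T (by omega)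
      have := E.weight_le_of_early (d := d) (m' := m + 1) htl hJr hJt (by omega) hβ0 hβt hSt
        (by exact_mod_cast hlt ((J.2 : ℤ) + (τ J.1).V m) (by omega))
      have := executed_nonneg (x := x) (J := J) (a := β)
      linarith
  · refine ⟨max ⌈S⌉ (o + 1), le_max_right _ _, max_le hcd hod, fun J h1 h2 => ?_,
      fun K _ _ _ _ => ?_, fun J hJr hJt hJL hoJ hJT => ?_⟩
    · have : (J.2 : ℤ) + (τ J.1).V m < ⌈S⌉ := by omega
      exact_mod_cast Int.lt_ceil.1 this
    · refine (E.ran_le_max hβ0).trans (max_le_max le_rfl (sub_le_sub_right ?_ _))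
      exact (Int.le_ceil S).trans (by exact_mod_cast le_max_left _ _)
    · by_contra hlt
      exact hex ⟨J, hJr, hJt, hJL, hoJ, hJT, not_le.1 hlt⟩

/-- The demand in an interval with integer origin `o` in which only urgent jobs run is at most the
length of the interval. The term `extra` of a carry-over job is what it must already have executed
between `o` and `β`, in excess of the bound from the test. -/
theorem sum_weight_le (E : Episode τ x t₀ h) (hτ : MCTaskSet.PassesTest τ)
    (hM : k + 2 ≤ MCTaskSet.maxLevel τ) (hfit : Fits τ x t₀ h (k + 1))
    (htl : Timely τ x t₀ h (k + 1)) (hSt : x.entry t₀ h (k + 2) ≤ t)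
    (ht : t ≤ x.entry t₀ h (k + 3)) (htd : t ≤ d) {o : ℤ} (hOβ : x.entry t₀ h (k + 1) ≤ β)
    (hβt : β ≤ t) (hβo : β ≤ o + 1) (hoβ : (o : ℝ) ≤ β ∨ β = t) (hod : o + 1 ≤ d)
    (hurg : ∀ u, β < u → u < t → u ≠ x.entry t₀ h (k + 2) → Urgent τ x t₀ h (k + 1) d u)
    {extra : MCJob n → ℝ} (hex : ∀ J, extra J ≤ max 0 (β - o))
    (hexS : x.entry t₀ h (k + 2) < β → ∀ J, extra J ≤ 0)
    (hexo : ∀ J : MCJob n, o < J.2 → extra J ≤ 0)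
    (hel : ∀ J : MCJob n, ¬ (t₀ ≤ J.2 ∧ k + 1 ≤ (τ J.1).L ∧ (J.2 : ℤ) + (τ J.1).V (k + 1) ≤ d) →
      extra J ≤ 0)
    (hcarry : ∀ J ∈ x.jobsUpTo h, t₀ ≤ J.2 → (J.2 : ℤ) ≤ o → k + 1 ≤ (τ J.1).L →
      (J.2 : ℤ) + (τ J.1).V (k + 1) ≤ d →
      weight τ x t₀ (k + 2) β t d J + extra J ≤ 0 ∨
      o ≤ (J.2 : ℤ) + (τ J.1).V k ∧ o - (τ J.1).T < J.2 ∧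
        o + 1 ≤ (J.2 : ℤ) + (τ J.1).V (k + 1) ∧
        extra J - x.executed J β ≤
          ((min ((J.2 : ℤ) - o + (τ J.1).V k) ((τ J.1).C k) - (τ J.1).C k : ℤ) : ℝ)) :
    ∑ J ∈ x.jobsUpTo h, (weight τ x t₀ (k + 2) β t d J + extra J) ≤ d - o := by
  obtain ⟨S', hoS', hS'd, hearly, hlow, hmid⟩ :=
    E.exists_switch (by omega) hfit htl hSt htd hOβ hβt hβo hod
  have hβ0 : t₀ ≤ β := (E.le_entry _).trans hOβ
  have hsum := MCTaskSet.sum_weight_le hτ hM (o := o) (S := S' - o) (e := d - o) (by omega) (by omega)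
    E.separated (w := fun J => weight τ x t₀ (k + 2) β t d J + extra J) ?_
  · exact_mod_cast hsum
  intro J hJ
  have hrel := release_of_mem_jobsUpTo hJ
  -- jobs that do not belong to the episode, or are not urgent, weigh nothing
  by_cases hJel : t₀ ≤ J.2 ∧ k + 1 ≤ (τ J.1).L ∧ (J.2 : ℤ) + (τ J.1).V (k + 1) ≤ d
  swap
  · left
    have h1 := hel J hJel
    have h2 : weight τ x t₀ (k + 2) β t d J = 0 := by
      by_cases hJt : t₀ ≤ J.2
      · exact E.weight_eq_zero_of_not_urgent hOβ ht hurg fun hn => hJel ⟨hJt, hn⟩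
      · rw [weight, residual_eq_zero fun hn => hJt hn.1.2.1, ran_eq_zero, add_zero]
        exact fun u hu _ hs => hJt (E.unfinished_of_sched (hβ0.trans hu.le) hs).2.1
    linarith
  obtain ⟨hJt, hJL, hJd⟩ := hJel
  by_cases hw0 : weight τ x t₀ (k + 2) β t d J + extra J ≤ 0
  · exact Or.inl hw0
  have hcarry' := fun hr => (hcarry J hJ hJt hr hJL hJd).resolve_left hw0
  have hV1 := (τ J.1).V_pos (m := k + 1) (by omega) hJL
  have hexe := executed_nonneg (x := x) (J := J) (a := β)
  have hlow' : ¬ (k + 2 ≤ (τ J.1).L ∧ (J.2 : ℤ) + (τ J.1).V (k + 2) ≤ d) →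
      weight τ x t₀ (k + 2) β t d J + extra J ≤ (τ J.1).C (k + 1) + (extra J - x.executed J β) ∧
      weight τ x t₀ (k + 2) β t d J + extra J ≤
        max 0 (((S' - o) - max ((J.2 : ℤ) - o) 0 : ℤ) : ℝ) := by
    intro hJlow
    have h1 := E.weight_le_ran hSt ht hurg hJlow
    have h2 := hlow J hrel hJt hJL hJlow
    have hoβ' : β < o → weight τ x t₀ (k + 2) β t d J + extra J ≤ 0 := by
      intro hlt
      have hβ' : β = t := hoβ.resolve_left (not_le.2 hlt)
      have h3 := hex J
      rw [max_eq_left (by linarith)] at h3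
      rw [ran_eq_zero fun u hu hut => by linarith] at h1
      linarith
    constructor
    · rcases le_or_gt β (x.entry t₀ h (k + 2)) with hβS | hβS
      · have h3 := executed_add_ran (E.run.measurable J) (E.nonneg hβ0) hβS
        have h4 := E.executed_le hJt (le_refl (x.entry t₀ h (k + 2))) hJL
        linarith
      · have h3 := hexS hβS J
        rw [ran_eq_zero fun u hu hut => by linarith] at h1
        exact absurd (by linarith) hw0
    · have hoβ'' : (o : ℝ) ≤ β := by
        by_contra hlt
        exact hw0 (hoβ' (not_le.1 hlt))
      have hexJ := hex J
      rw [max_eq_right (by linarith)] at hexJ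
      have hoS : ((o : ℝ) + 1) ≤ S' := by exact_mod_cast hoS'
      rcases le_or_gt (J.2 : ℤ) o with hr | hr
      · have h4 : max 0 ((S' : ℝ) - max β J.2) ≤ S' - β :=
          max_le (by linarith) (by linarith [le_max_left β (J.2 : ℝ)])
        refine le_trans ?_ (le_max_right _ _)
        rw [max_eq_right (by omega)]
        push_cast
        linarith
      · have h4 := hexo J hr
        have h5 : β ≤ J.2 := hβo.trans (by exact_mod_cast (by omega : o + 1 ≤ (J.2 : ℤ)))
        rw [max_eq_right h5] at h2
        rw [max_eq_left (show (0 : ℤ) ≤ (J.2 : ℤ) - o by omega), sub_sub_sub_cancel_right]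
        push_cast
        linarith
  refine MCTask.weightBounded_of (X := extra J - x.executed J β) hJL (by omega) (by omega) ?_ ?_ ?_
    ?_ ?_ ?_ ?_
  · intro hr
    obtain ⟨h1, h2, -, h3⟩ := hcarry' (by omega)
    exact ⟨by omega, by omega, h3⟩
  · intro hr
    have := hexo J (by omega)
    linarith
  · intro hL hS
    have h1 : o + 1 ≤ (J.2 : ℤ) + (τ J.1).V (k + 1) := by
      rcases le_or_gt (J.2 : ℤ) o with hr | hr
      · exact (hcarry' hr).2.2.1
      · omega
    have := E.weight_le_of_early (d := d) (m' := k + 2) htl hrel hJt hJL hβ0 hβt hSt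
      (hearly J h1 (by omega))
    linarith
  · intro hL
    have := E.weight_le (d := d) hJt hL hβ0 hβt ht
    linarith
  · intro hL
    by_cases hd : (J.2 : ℤ) + (τ J.1).V (k + 2) ≤ d
    · exact Or.inl (by omega)
    · exact Or.inr (hlow' fun hn => hd hn.2)
  · intro hL
    exact hlow' fun hn => by omega
  · intro hL hr hT
    have h1 := hmid J hrel hJt hL (by omega) (by omega)
    have h2 := hexo J (by omega)
    linarith

/-- The residual demand of all jobs fits if only urgent jobs run on `[β, t)` and the demand of
`sum_weight_le` fits. -/
theorem sum_residual_le (E : Episode τ x t₀ h) (hβ : t₀ ≤ β) (hβt : β ≤ t) (hth : t ≤ h)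
    {extra : MCJob n → ℝ} {c : ℝ}
    (hsum : ∑ J ∈ x.jobsUpTo h, (weight τ x t₀ m β t d J + extra J) ≤ c) :
    ∑ J ∈ x.jobsUpTo h, residual τ x t₀ m t d J ≤
      c - ∑ J ∈ x.jobsUpTo h, extra J - (t - β) := by
  have h1 := E.sub_le_sum_ran hβ hβt hth
  simp only [weight, Finset.sum_add_distrib] at hsum
  linarith

/-- A job that is carried over into mode `k + 1` has executed for its level-`k` budget, up to what
it can still execute before its level-`k` virtual deadline. -/
theorem carryOver (E : Episode τ x t₀ h) (hfit : 1 ≤ k → Fits τ x t₀ h k) (htl : Timely τ x t₀ h k)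
    {J : MCJob n} (hJ : x.Unfinished t₀ J (x.entry t₀ h (k + 1)))
    (hr : (J.2 : ℝ) < x.entry t₀ h (k + 1)) (hL : k ≤ (τ J.1).L) :
    1 ≤ k ∧ x.entry t₀ h (k + 1) ≤ J.2 + (τ J.1).V k ∧
      (τ J.1).C k - x.executed J (x.entry t₀ h (k + 1)) ≤
        J.2 + (τ J.1).V k - x.entry t₀ h (k + 1) := by
  have hk : 1 ≤ k := by
    by_contra hk
    obtain rfl : k = 0 := by omega
    rw [zero_add, E.entry_one] at hr
    exact absurd hJ.start_le (not_le.2 hr)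
  have hle : x.entry t₀ h (k + 1) ≤ J.2 + (τ J.1).V k := by
    refine le_of_forall_lt fun u hu => ?_
    rcases lt_or_ge u J.2 with h1 | h1
    · have : (0 : ℝ) ≤ (τ J.1).V k := by positivity
      linarith
    · exact htl u (hJ.start_le.trans h1) hu J (hJ.of_le h1 hu.le) hL
  refine ⟨hk, hle, ?_⟩
  have := E.residual_le (hfit hk) (E.entry_mono (by omega)) le_rfl
    (d := (J.2 : ℤ) + (τ J.1).V k) (by push_cast; exact hle) hJ hL le_rfl
  push_cast at this
  exact this

end Episode

end MCTrace

namespace MCTrace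

variable {n : ℕ} {τ : Fin n → MCTask} {x : MCTrace n} {t₀ : ℕ} {h : ℝ} {m k : ℕ}

namespace Episode

/-- In mode `1`, the residual demand fits by the ordinary processor demand criterion. -/
theorem fits_one (E : Episode τ x t₀ h) (hτ : MCTaskSet.PassesTest τ)
    (hM : 1 ≤ MCTaskSet.maxLevel τ) : Fits τ x t₀ h 1 := by
  intro t hSt ht d htd
  -- from the integer `o` on, only jobs released at `o` or later run urgently
  have key : ∀ o : ℤ, (t₀ : ℝ) ≤ o →
      (∀ u, (o : ℝ) < u → u < t → u ≠ x.entry t₀ h 1 → Urgent τ x t₀ h 0 d u) →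
      (∀ J : MCJob n, (J.2 : ℤ) < o → residual τ x t₀ 1 t d J = 0 ∧
        ∀ u, (o : ℝ) < u → u < t → u ≠ x.entry t₀ h 1 → x.sched u ≠ some J) →
      ∑ J ∈ x.jobsUpTo h, residual τ x t₀ 1 t d J ≤ d - t := by
    intro o ho hurg hrel
    rcases le_or_gt (o + 1) d with hod | hod
    swap
    · refine (Finset.sum_nonpos fun J _ => ?_).trans (sub_nonneg.2 htd)
      by_contra hne
      have hJo : ¬ (J.2 : ℤ) < o := fun hlt => hne (hrel J hlt).1.le
      refine hne (residual_eq_zero fun hn => ?_).le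
      have := (τ J.1).V_pos le_rfl hn.2.1
      have := hn.2.2
      omega
    set β := min (o : ℝ) t with hβ
    have hβ0 : t₀ ≤ β := le_min ho (E.entry_one ▸ hSt)
    have hβt : β ≤ t := min_le_right _ _
    have hurg' : ∀ u, β < u → u < t → (o : ℝ) < u := fun u hu hut => by
      rcases min_lt_iff.1 hu with h | h
      · exact h
      · linarith
    have hsum := MCTaskSet.sum_weight_le_one hτ hM (o := o) (e := d - o) (by omega) E.separated
      (w := fun J => weight τ x t₀ 1 β t d J + 0) ?_
    · have := E.sum_residual_le hβ0 hβt (ht.trans (E.entry_le _)) hsum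
      have h1 : β ≤ o := min_le_left _ _
      push_cast at this
      simp only [Finset.sum_const_zero] at this
      linarith
    · intro J hJ
      by_cases hJo : (J.2 : ℤ) < o
      · left
        obtain ⟨h1, h2⟩ := hrel J hJo
        simp only [weight, h1, ran_eq_zero_of_ne fun u hu hut => h2 u (hurg' u hu hut) hut]
        simp
      by_cases hJd : 1 ≤ (τ J.1).L ∧ (J.2 : ℤ) + (τ J.1).V 1 ≤ d
      · right
        by_cases hJt : t₀ ≤ J.2
        · have h1 := E.weight_le (d := d) hJt hJd.1 hβ0 hβt ht
          have h2 := executed_nonneg (x := x) (J := J) (a := β)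
          exact ⟨by omega, by omega, by linarith⟩
        · have h1 : (t₀ : ℤ) ≤ o := by exact_mod_cast ho
          omega
      · left
        have h1 := E.weight_le_ran (k := 0) hSt ht
          (fun u hu hut huS => hurg u (hurg' u hu hut) hut huS) hJd
        rw [ran_eq_zero fun u hu hut => by
          rw [zero_add, E.entry_one] at hut
          linarith] at h1
        linarith
  rcases E.busy_start (k := 0) ht d with hurg | ⟨b, hb, hurg, hrel⟩
  · have h0 : x.entry t₀ h 0 ≤ t₀ := (E.entry_mono (Nat.zero_le 1)).trans E.entry_one.le
    refine key t₀ (by simp) (fun u hu hut huS =>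
      hurg u (h0.trans_lt (by exact_mod_cast hu)) hut huS) fun J hJ => ?_
    have hJ' : J.2 < t₀ := by exact_mod_cast hJ
    refine ⟨residual_eq_zero fun hn => by have := hn.1.2.1; omega, fun u hu _ _ hs => ?_⟩
    have := (E.unfinished_of_sched (by exact_mod_cast hu.le) hs).2.1
    omega
  · exact key b ((E.le_entry 0).trans hb.le) hurg hrel

/-- The residual demand fits in mode `k + 2` if it does so in the two modes before. -/
theorem fits_add_two (E : Episode τ x t₀ h) (hτ : MCTaskSet.PassesTest τ)
    (hM : k + 2 ≤ MCTaskSet.maxLevel τ) (hfit₀ : 1 ≤ k → Fits τ x t₀ h k)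
    (htl₀ : Timely τ x t₀ h k) (hfit : Fits τ x t₀ h (k + 1)) (htl : Timely τ x t₀ h (k + 1)) :
    Fits τ x t₀ h (k + 2) := by
  intro t hSt ht d htd
  have hth : t ≤ h := ht.trans (E.entry_le _)
  have hOS : x.entry t₀ h (k + 1) ≤ x.entry t₀ h (k + 2) := E.entry_mono (by omega)
  have ht₀O : (t₀ : ℝ) ≤ x.entry t₀ h (k + 1) := E.le_entry _
  -- with an origin `o` at or after the start of the busy interval
  have key : ∀ o : ℤ, x.entry t₀ h (k + 1) ≤ o →
      (∀ u, (o : ℝ) < u → u < t → u ≠ x.entry t₀ h (k + 2) → Urgent τ x t₀ h (k + 1) d u) →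
      (∀ J : MCJob n, t₀ ≤ J.2 → (J.2 : ℤ) < o → k + 1 ≤ (τ J.1).L →
        (J.2 : ℤ) + (τ J.1).V (k + 1) ≤ d → (residual τ x t₀ (k + 2) t d J = 0 ∧
          ∀ u, (o : ℝ) < u → u < t → u ≠ x.entry t₀ h (k + 2) → x.sched u ≠ some J) ∨
        1 ≤ k ∧ o + (τ J.1).C k ≤ (J.2 : ℤ) + (τ J.1).V k) →
      ∑ J ∈ x.jobsUpTo h, residual τ x t₀ (k + 2) t d J ≤ d - t := by
    intro o hOo hurg hcarry
    rcases le_or_gt (o + 1) d with hod | hod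
    swap
    · refine (Finset.sum_nonpos fun J _ => ?_).trans (sub_nonneg.2 htd)
      by_contra hne
      refine hne (residual_eq_zero fun ⟨hun, hL, hd⟩ => ?_).le
      have hV := (τ J.1).V_pos (m := k + 2) (by omega) hL
      have hV1 := (τ J.1).V_le_of_le (m := k + 1) (m' := k + 2) (by omega) hL
      have hV2 := (τ J.1).V_le_of_le (m := k) (m' := k + 2) (by omega) hL
      have hJo : (J.2 : ℤ) < o := by omega
      rcases hcarry J hun.2.1 hJo (by omega) (by omega) with h1 | ⟨hk, h1⟩
      · exact hne h1.1.le
      · have hC := (τ J.1).C_pos hk (by omega)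
        omega
    set β := min (o : ℝ) t with hβ
    have hOβ : x.entry t₀ h (k + 1) ≤ β := le_min hOo (hOS.trans hSt)
    have hβt : β ≤ t := min_le_right _ _
    have hβo : β ≤ o := min_le_left _ _
    have hurg' : ∀ u, β < u → u < t → (o : ℝ) < u := fun u hu hut => by
      rcases min_lt_iff.1 hu with h | h
      · exact h
      · linarith
    have hsum := E.sum_weight_le hτ hM hfit htl hSt ht htd (o := o) hOβ hβt (by linarith)
      (by rcases min_choice (o : ℝ) t with h | h
          · exact Or.inl h.ge
          · exact Or.inr h) hod
      (fun u hu hut huS => hurg u (hurg' u hu hut) hut huS) (extra := fun _ => 0)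
      (fun _ => le_max_left _ _) (fun _ _ => le_rfl) (fun _ _ => le_rfl) (fun _ _ => le_rfl) ?_
    · have := E.sum_residual_le (ht₀O.trans hOβ) hβt hth hsum
      simp only [Finset.sum_const_zero] at this
      linarith
    · intro J hJ hJt hJo hL hd
      have hV := (τ J.1).V_pos (m := k + 1) (by omega) hL
      have hVV : (τ J.1).V k ≤ (τ J.1).V (k + 1) := (τ J.1).V_le_succ hL
      have hVT : (τ J.1).V k ≤ (τ J.1).T := (τ J.1).V_le_T (by omega)
      have hT := (τ J.1).T_pos
      have hexe := executed_nonneg (x := x) (J := J) (a := β)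
      rcases hJo.lt_or_eq with hlt | heq
      · rcases hcarry J hJt hlt hL hd with ⟨h1, h2⟩ | ⟨hk, h1⟩
        · left
          rw [weight, h1, ran_eq_zero_of_ne fun u hu hut => h2 u (hurg' u hu hut) hut]
          simp
        · right
          have hC := (τ J.1).C_pos hk (by omega)
          refine ⟨by omega, by omega, by omega, ?_⟩
          rw [min_eq_right (by omega)]
          push_cast
          linarith
      · right
        have hCV := MCTaskSet.C_le_V hτ J.1 k (by omega)
        refine ⟨by omega, by omega, by omega, ?_⟩
        rw [min_eq_right (by omega)]
        push_cast
        linarith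
  rcases E.busy_start (k := k + 1) ht d with hurg | ⟨b, hb, hurg, hrel⟩
  swap
  · exact key b hb.le hurg fun J _ hJ _ _ => Or.inl (hrel J hJ)
  set O := x.entry t₀ h (k + 1) with hO
  have hceil : ((⌈O⌉ - 1 : ℤ) : ℝ) < O := by
    have := Int.ceil_lt_add_one O
    push_cast
    linarith
  have hOceil := Int.le_ceil O
  have hltceil : ∀ z : ℤ, (z : ℝ) < O ↔ z < ⌈O⌉ := fun z => Int.lt_ceil.symm
  by_cases hact : ∃ I : MCJob n, x.Unfinished t₀ I O ∧ (I.2 : ℝ) < O ∧ k + 1 ≤ (τ I.1).L ∧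
      (I.2 : ℤ) + (τ I.1).V (k + 1) ≤ d ∧ (I.2 : ℤ) + (τ I.1).V k < ⌈O⌉ + (τ I.1).C k
  · -- the demand of the carry-over job `I` shrinks as fast as the interval when the origin moves
    -- from `⌈O⌉ - 1` to `O`
    classical
    obtain ⟨I, hIun, hI_lt, hIL, hId, hIC⟩ := hact
    set o : ℤ := ⌈O⌉ - 1 with ho
    have hOo : O ≤ o + 1 := by
      rw [ho]
      push_cast
      linarith
    have hod : o + 1 ≤ d := by
      have : O ≤ d := hOS.trans (hSt.trans htd)
      have := Int.ceil_le.2 this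
      omega
    have hIo : (I.2 : ℤ) ≤ o := by
      have := (hltceil I.2).1 (by exact_mod_cast hI_lt)
      omega
    have hsum := E.sum_weight_le hτ hM hfit htl hSt ht htd (o := o) le_rfl (hOS.trans hSt) hOo
      (Or.inl hceil.le) hod hurg (extra := fun J => if J = I then O - o else 0)
      (fun J => ?_) (fun hlt => absurd hlt (not_lt.2 hOS)) (fun J hJ => ?_) (fun J hJ => ?_) ?_
    · have := E.sum_residual_le ht₀O (hOS.trans hSt) hth hsum
      rw [Finset.sum_ite_eq' _ I, if_pos (E.mem_jobsUpTo hIun le_rfl)] at this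
      linarith
    · split_ifs
      · exact le_max_right _ _
      · exact le_max_left _ _
    · rw [if_neg]
      rintro rfl
      omega
    · rw [if_neg]
      rintro rfl
      exact hJ ⟨hIun.2.1, hIL, hId⟩
    · intro J hJ hJt hJo hL hd
      have hJO : (J.2 : ℝ) < O := by
        have := (hltceil J.2).2 (by omega)
        exact_mod_cast this
      by_cases hf : x.Finished J O
      · left
        rw [if_neg, E.weight_eq_zero_of_finished ht₀O (hOS.trans hSt) hf, add_zero]
        rintro rfl
        exact hIun.2.2.2 hf
      right
      have hun : x.Unfinished t₀ J O := ⟨release_of_mem_jobsUpTo hJ, hJt, hJO.le, hf⟩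
      obtain ⟨hk, h1, h2⟩ := E.carryOver hfit₀ htl₀ hun hJO (by omega)
      have hVV : (τ J.1).V k ≤ (τ J.1).V (k + 1) := (τ J.1).V_le_succ hL
      have hVT : (τ J.1).V k ≤ (τ J.1).T := (τ J.1).V_le_T (by omega)
      have h3 : o + 1 ≤ (J.2 : ℤ) + (τ J.1).V k := by
        have : ⌈O⌉ ≤ (J.2 : ℤ) + (τ J.1).V k := Int.ceil_le.2 (by exact_mod_cast h1)
        omega
      refine ⟨by omega, by omega, by omega, ?_⟩
      have h4 := executed_nonneg (x := x) (J := J) (a := O)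
      push_cast
      split_ifs with hJI
      · subst hJI
        rw [min_eq_left]
        · linarith
        · exact_mod_cast (by omega : (J.2 : ℤ) - o + (τ J.1).V k ≤ (τ J.1).C k)
      · have h5 : -x.executed J O + (τ J.1).C k ≤
            min ((J.2 : ℝ) - o + (τ J.1).V k) ((τ J.1).C k) :=
          le_min (by linarith) (by linarith)
        linarith
  · refine key ⌈O⌉ hOceil (fun u hu hut huS => hurg u (hOceil.trans_lt hu) hut huS)
      fun J hJt hJo hL hd => ?_
    have hJO : (J.2 : ℝ) < O := by exact_mod_cast (hltceil J.2).2 hJo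
    by_cases hrel : J.2 ∈ x.releases J.1 ∧ ¬ x.Finished J O
    · have hun : x.Unfinished t₀ J O := ⟨hrel.1, hJt, hJO.le, hrel.2⟩
      right
      refine ⟨(E.carryOver hfit₀ htl₀ hun hJO (by omega)).1, ?_⟩
      by_contra hlt
      exact hact ⟨J, hun, hJO, hL, hd, by omega⟩
    · left
      refine ⟨residual_eq_zero fun hn => hrel ⟨hn.1.1, (hn.1.of_le hJO.le (hOS.trans hSt)).2.2.2⟩,
        fun u hu _ _ hs => ?_⟩
      have hOu := hOceil.trans hu.le
      have hun := E.unfinished_of_sched (ht₀O.trans hOu) hs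
      exact hrel ⟨hun.1, (hun.of_le hJO.le hOu).2.2.2⟩

/-- Strong induction: `Fits` in mode `k + 2` rests on both invariants in modes `k` and `k + 1`, and
`Timely` passes from each mode to the next by `Fits`. -/
theorem fits_and_timely (E : Episode τ x t₀ h) (hτ : MCTaskSet.PassesTest τ) (m : ℕ)
    (hm : m ≤ MCTaskSet.maxLevel τ) : (1 ≤ m → Fits τ x t₀ h m) ∧ Timely τ x t₀ h m := by
  induction m using Nat.strong_induction_on with
  | _ m ih =>
    rcases m with _ | _ | k
    · exact ⟨fun h => absurd h (by omega), E.timely_zero⟩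
    · have hfit := E.fits_one hτ hm
      exact ⟨fun _ => hfit, E.timely_succ E.timely_zero hfit⟩
    · have h0 := ih k (by omega) (by omega)
      have h1 := ih (k + 1) (by omega) (by omega)
      have hfit := E.fits_add_two hτ hm h0.1 h0.2 (h1.1 (by omega)) h1.2
      exact ⟨fun _ => hfit, E.timely_succ h1.2 hfit⟩

end Episode

end MCTrace

namespace MCTaskSet

variable {n : ℕ} {τ : Fin n → MCTask}

/-- A late job would end an episode, and its residual demand at its deadline would not fit. -/
theorem edfSchedulable_of_passesTest (hτ : PassesTest τ) : EDFSchedulable τ := by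
  intro x hx m hm hmM J hJ hL hdem hmode
  by_contra hlate
  set h : ℝ := (J.2 : ℝ) + (τ J.1).D with hh
  have hD : (1 : ℝ) ≤ (τ J.1).D := by exact_mod_cast (τ J.1).one_le_D
  have hun : ∀ u : ℝ, J.2 ≤ u → u < h → MCTrace.Pending τ x J u := fun u hu huh =>
    ⟨hJ, hu, fun hf => hlate (hf.mono huh.le), fun s hs hsu =>
      (hmode s hs (hsu.trans_lt huh)).trans hL⟩
  obtain ⟨t₀, ht₀, E⟩ := MCTrace.exists_episode hx (show (J.2 : ℝ) < h by linarith) hun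
  have hentry : x.entry t₀ h (m + 1) = h := by
    refine le_antisymm (E.entry_le _) (not_lt.1 fun hlt => ?_)
    obtain ⟨u, hu1, hu2⟩ := exists_between (max_lt hlt (show (J.2 : ℝ) < h by linarith))
    have h1 := E.le_mode ((le_max_left _ _).trans_lt hu1) hu2
    have h2 := hmode u ((le_max_right _ _).trans hu1.le) hu2
    omega
  obtain ⟨hfit, htl⟩ := E.fits_and_timely hτ m hmM
  have hV : ((τ J.1).V m : ℝ) ≤ (τ J.1).D := by exact_mod_cast (τ J.1).V_le_D_of_le hL
  have hle := E.residual_le (hfit hm) (t := h) (E.entry_le m) hentry.ge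
    (d := (J.2 : ℤ) + (τ J.1).D) (by push_cast; exact hh.le) ⟨hJ, ht₀, by linarith, hlate⟩ hL
    (by exact_mod_cast (by linarith : (J.2 : ℝ) + (τ J.1).V m ≤ J.2 + (τ J.1).D))
  push_cast at hle
  exact hlate (show x.demand J ≤ x.executed J h by linarith)

end MCTaskSet

theorem mainTheorem1 :
    ∃ eMax : ∀ n : ℕ, (Fin n → MCTask) → ℕ∞,
      -- the schedulability test
      (∀ (n : ℕ) (τ : Fin n → MCTask),
        (∀ m : ℕ, 1 ≤ m → m ≤ MCTaskSet.maxLevel τ →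
          ∀ e : ℕ, 1 ≤ e → (e : ℕ∞) ≤ eMax n τ →
            ∀ S : ℕ, 1 ≤ S → S ≤ e → MCTaskSet.dbfMM τ S e m ≤ e) →
        MCTaskSet.EDFSchedulable τ) ∧
      -- the demand bound is never exceeded at an interval length beyond `eMax`
      (∀ (n : ℕ) (τ : Fin n → MCTask) (m e S : ℕ), 1 ≤ m → m ≤ MCTaskSet.maxLevel τ →
        1 ≤ S → S ≤ e → (e : ℤ) < MCTaskSet.dbfMM τ S e m → (e : ℕ∞) ≤ eMax n τ) ∧
      -- `eMax` is pseudo-polynomial if all utilizations are bounded by a constant below `1`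
      (∀ c : ℝ, c < 1 → ∃ p : Polynomial ℕ, ∀ (n : ℕ) (τ : Fin n → MCTask),
        (∀ m : ℕ, 1 ≤ m → m ≤ MCTaskSet.maxLevel τ → MCTaskSet.utilization τ m ≤ c) →
        eMax n τ ≤ (p.eval (MCTaskSet.unarySize τ) : ℕ)) := by
  refine ⟨fun _ τ => MCTaskSet.testBound τ, fun n τ h => ?_, fun n τ m e S hm hmM hS hSe hlt => ?_,
    fun c hc => ⟨Polynomial.C ⌈3 / (1 - c)⌉₊ * Polynomial.X, fun n τ h => ?_⟩⟩
  · exact MCTaskSet.edfSchedulable_of_passesTest (MCTaskSet.passesTest_of_le_testBound h)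
  · exact MCTaskSet.le_testBound ⟨m, S, hm, hmM, hS, hSe, hlt⟩
  · simpa using MCTaskSet.testBound_le hc h
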